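/- For a matroid $M$ on $[7]=\{1,\dots,7\}$ and a collection $\gamma=(\gamma_1,\dots,\gamma_7)$ of vectors in $\mathbb{C}^3$, say that $\gamma$ is a realization of $M$ if, for every $S\subseteq[7]$, the family $(\gamma_i)_{i\in S}$ is linearly dependent if and only if $S$ is dependent in $M$. Let $V_M\subseteq\mathbb{C}^{21}$ be the Zariski closure of the set of realizations of $M$ in $\mathbb{C}^3$ (the matroid variety), and let $V_{\mathcal{C}(M)}\subseteq\mathbb{C}^{21}$ be the set of all $\gamma$ such that $(\gamma_i)_{i\in S}$ is linearly dependent for every dependent set $S$ of $M$ (the circuit variety). Let $M_{\mathrm{Fano}}$ be the Fano matroid, that is, the simple rank-three matroid on $[7]$ with lines $\{1,2,3\},\{1,5,6\},\{1,4,7\},\{2,5,7\},\{2,4,6\},\{3,4,5\},\{3,6,7\}$. Consider the following $22$ matroids on $[7]$: - the uniform matroid $U_{2,7}$ of rank two; - for $i\in[7]$, the matroid $M_{\mathrm{Fano}}(i)$ obtained from $M_{\mathrm{Fano}}$ by turning $i$ into a loop, i.e. with circuits $\mathcal{C}(M_{\mathrm{Fano}}\setminus i)\cup\{\{i\}\}$;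 - for $j\in[7]$, with $\ell_j$ the $j$-th line of $M_{\mathrm{Fano}}$, the rank-three matroid $A_j$ in which the three points of $\ell_j$ are distinct and lie on a line and the remaining four points coincide outside this line: a set $I$ is independent if and only if $|I\cap \ell_j|\le 2$ and $|I\setminus \ell_j|\le 1$; - for $k\in[7]$, the rank-three matroid $B_k$ in which, for each of the three lines $\{k,x,y\}$ of $M_{\mathrm{Fano}}$ through $k$, the points $x,y$ form a double point, the three double points are distinct and lie on a line, and $k$ is a free point outside this line: a set $I$ is independent if and only if $|I\setminus\{k\}|\le 2$ and $I$ contains no pair $\{x,y\}$ such that $\{k,x,y\}$ is a line of $M_{\mathrm{Fano}}$. Then $$V_{\mathcal{C}(M_{\mathrm{Fano}})}=V_{U_{2,7}}\cup\bigcup_{i=1}^{7}V_{M_{\mathrm{Fano}}(i)}\cup\bigcup_{j=1}^{7}V_{A_j}\cup\bigcup_{k=1}^{7}V_{B_k},$$ and this is the irreducible decomposition of $V_{\mathcal{C}(M_{\mathrm{Fano}})}$: the irreducible components of $V_{\mathcal{C}(M_{\mathrm{Fano}})}$ in the Zariski topology are exactly the $22$ varieties on the right-hand side, and these are pairwise distinct.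 -/

import Mathlib

open Set
open scoped Matroid

/-! ### Configurations of vectors and the Zariski topology -/

/-- The space `ℂ^{nd}` of collections of `d` vectors in `ℂ^n` (equivalently, `n × d` matrices with
columns indexed by `Fin d`). It carries the Zariski topology, see below. -/
def VectorConfig (n d : ℕ) : Type := Fin d → Fin n → ℂ

namespace VectorConfig

/-- The `i`-th vector of a collection. -/
def vec {n d : ℕ} (γ : VectorConfig n d) (i : Fin d) : Fin n → ℂ := γ i

/-- The `n d` coordinates of a collection of vectors, as a point of affine space. -/
def coords {n d : ℕ} (γ : VectorConfig n d) : Fin d × Fin n → ℂ := fun p => γ.vec p.1 p.2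

/-- The common zero set in `ℂ^{nd}` of a set of polynomials in the `n d` coordinates. -/
def zeroSet {n d : ℕ} (S : Set (MvPolynomial (Fin d × Fin n) ℂ)) : Set (VectorConfig n d) :=
  {γ | ∀ p ∈ S, MvPolynomial.eval γ.coords p = 0}

/-- The Zariski topology: the closed sets are the zero sets of sets of polynomials. -/
instance zariskiTopology (n d : ℕ) : TopologicalSpace (VectorConfig n d) :=
  TopologicalSpace.ofClosed (Set.range zeroSet)
    ⟨{1}, by ext γ; simp [zeroSet]⟩
    (by
      intro A hA
      refine ⟨⋃₀ {S | zeroSet S ∈ A}, ?_⟩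
      ext γ
      constructor
      · intro h Z hZ
        obtain ⟨S, rfl⟩ := hA hZ
        exact fun p hp => h p ⟨S, hZ, hp⟩
      · rintro h p ⟨S, hS, hp⟩
        exact h _ hS p hp)
    (by
      rintro _ ⟨S, rfl⟩ _ ⟨T, rfl⟩
      refine ⟨{r | ∃ p ∈ S, ∃ q ∈ T, r = p * q}, ?_⟩
      ext γ
      constructor
      · intro h
        by_contra hc
        simp only [Set.mem_union, not_or, zeroSet, Set.mem_ofPred_eq, not_forall] at hc
        obtain ⟨⟨p, hp, hp0⟩, ⟨q, hq, hq0⟩⟩ := hc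
        have := h (p * q) ⟨p, hp, q, hq, rfl⟩
        rw [map_mul] at this
        exact (mul_ne_zero hp0 hq0) this
      · rintro (h | h) r ⟨p, hp, q, hq, rfl⟩
        · rw [map_mul, h p hp, zero_mul]
        · rw [map_mul, h q hq, mul_zero])

end VectorConfig

/-- The realizations of `M` in `ℂ^n`: the subsets of the ground set that are dependent in `M` are
exactly those that index linearly dependent families of vectors. -/
def realizationSpace (n : ℕ) {d : ℕ} (M : Matroid (Fin d)) : Set (VectorConfig n d) :=
  {γ | ∀ S : Set (Fin d), ¬ LinearIndepOn ℂ γ.vec S ↔ M.Dep S}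

/-- The matroid variety of `M` in `ℂ^{nd}`: the Zariski closure of the realization space. -/
def matroidVariety (n : ℕ) {d : ℕ} (M : Matroid (Fin d)) : Set (VectorConfig n d) :=
  closure (realizationSpace n M)

/-- The circuit variety of `M` in `ℂ^{nd}`: the collections of vectors that include the
dependencies of `M`. -/
def circuitVariety (n : ℕ) {d : ℕ} (M : Matroid (Fin d)) : Set (VectorConfig n d) :=
  {γ | ∀ S : Set (Fin d), M.Dep S → ¬ LinearIndepOn ℂ γ.vec S}

/-- The set of irreducible components of a subset `V` of a topological space, as subsets of the
ambient space. -/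
def componentsOf {X : Type*} [TopologicalSpace X] (V : Set X) : Set (Set X) :=
  (fun Z : Set V => Subtype.val '' Z) '' irreducibleComponents V

/-! ### The matroids -/

/-- The uniform matroid `U_{n,d}`: a set is independent if and only if it has at most `n`
elements. -/
def uniformMatroid (n d : ℕ) : Matroid (Fin d) :=
  (IndepMatroid.ofFinset Set.univ (fun I : Finset (Fin d) => I.card ≤ n)
    (by simp)
    (fun _ _ hJ h => (Finset.card_le_card h).trans hJ)
    (fun I J _ hJ h => by
      obtain ⟨e, heJ, heI⟩ := Finset.exists_mem_notMem_of_card_lt_card h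
      exact ⟨e, heJ, heI, (Finset.card_insert_le e I).trans (by omega)⟩)
    (fun _ _ => Set.subset_univ _)).matroid

/-- A point-line configuration on `d` points: a set of lines, each with at least three points, such
that two distinct points lie on at most one common line. -/
structure PointLineConfig (d : ℕ) where
  /-- the lines -/
  lines : Finset (Finset (Fin d))
  three_le : ∀ l ∈ lines, 3 ≤ l.card
  line_unique : ∀ l ∈ lines, ∀ l' ∈ lines, ∀ x y : Fin d, x ≠ y →
    x ∈ l → y ∈ l → x ∈ l' → y ∈ l' → l = l'

/-- The simple matroid of rank at most three of a point-line configuration: the independent sets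
are the sets of at most two points and the triples of points that do not lie on a line. -/
def PointLineConfig.matroid {d : ℕ} (P : PointLineConfig d) : Matroid (Fin d) :=
  (IndepMatroid.ofFinset Set.univ
    (fun I : Finset (Fin d) => I.card ≤ 3 ∧ (I.card = 3 → ∀ l ∈ P.lines, ¬ I ⊆ l))
    (by simp)
    (fun I J hJ h => by
      refine ⟨(Finset.card_le_card h).trans hJ.1, fun hI => ?_⟩
      have : I = J := Finset.eq_of_subset_of_card_le h (hI ▸ hJ.1)
      exact this ▸ hJ.2 (this ▸ hI))
    (fun I J hI hJ h => by
      by_cases h2 : I.card = 2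
      · have hJ3 : J.card = 3 := by have := hJ.1; omega
        obtain ⟨a, b, hab, rfl⟩ := Finset.card_eq_two.1 h2
        by_contra hc
        push Not at hc
        have key : ∀ e ∈ J, e ∉ ({a, b} : Finset (Fin d)) →
            ∃ l ∈ P.lines, insert e ({a, b} : Finset (Fin d)) ⊆ l := by
          intro e heJ heI
          by_contra hn
          push Not at hn
          have h3 := Finset.card_insert_of_notMem heI
          obtain ⟨_, l, hl, hel⟩ := hc e heJ heI (by omega)
          exact hn l hl hel
        obtain ⟨e, heJ, heI⟩ := Finset.exists_mem_notMem_of_card_lt_card h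
        obtain ⟨l, hl, hel⟩ := key e heJ heI
        have hal : a ∈ l := hel (by simp)
        have hbl : b ∈ l := hel (by simp)
        refine hJ.2 hJ3 l hl (fun x hx => ?_)
        by_cases hxI : x ∈ ({a, b} : Finset (Fin d))
        · rcases Finset.mem_insert.1 hxI with rfl | hxb
          · exact hal
          · exact (Finset.mem_singleton.1 hxb) ▸ hbl
        · obtain ⟨l', hl', hxl'⟩ := key x hx hxI
          have := P.line_unique l hl l' hl' a b hab hal hbl (hxl' (by simp)) (hxl' (by simp))
          exact this ▸ hxl' (by simp)
      · obtain ⟨e, heJ, heI⟩ := Finset.exists_mem_notMem_of_card_lt_card h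
        have h3 := Finset.card_insert_of_notMem heI
        have := hJ.1
        exact ⟨e, heJ, heI, by omega, fun h' => by omega⟩)
    (fun _ _ => Set.subset_univ _)).matroid

/-- The matroid `M(i)` obtained from `M` by turning `i` into a loop: delete `i`, and add it back to
the ground set as a loop. -/
def Matroid.makeLoop {α : Type*} (M : Matroid α) (i : α) : Matroid α :=
  (M ↾ (M.E \ {i})) ↾ M.E

/-- The seven lines of the Fano plane. The points `1, …, 7` are written `0, …, 6`. -/
def fanoLine : Fin 7 → Finset (Fin 7) :=
  ![{0, 1, 2}, {0, 4, 5}, {0, 3, 6}, {1, 4, 6}, {1, 3, 5}, {2, 3, 4}, {2, 5, 6}]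

set_option maxRecDepth 20000 in
/-- The Fano plane as a point-line configuration. -/
def fanoConfig : PointLineConfig 7 where
  lines := Finset.univ.image fanoLine
  three_le := by decide
  line_unique := by decide

/-- The Fano matroid. -/
def fano : Matroid (Fin 7) := fanoConfig.matroid

/-- The matroid whose restriction to `l` is uniform of rank two (a line) and whose remaining points
are nonzero, parallel to each other, and outside of that line: a set is independent if and only if
it has at most two points in `l` and at most one point outside of `l`. -/
def lineAndMultiplePoint {d : ℕ} (l : Finset (Fin d)) : Matroid (Fin d) :=
  (IndepMatroid.ofFinset Set.univ
    (fun I : Finset (Fin d) => (I ∩ l).card ≤ 2 ∧ (I \ l).card ≤ 1)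
    (by simp)
    (fun I J hJ h =>
      ⟨(Finset.card_le_card (Finset.inter_subset_inter_right h)).trans hJ.1,
        (Finset.card_le_card (Finset.sdiff_subset_sdiff h subset_rfl)).trans hJ.2⟩)
    (fun I J hI hJ h => by
      have h1 := Finset.card_inter_add_card_sdiff I l
      have h2 := Finset.card_inter_add_card_sdiff J l
      by_cases hlt : (I ∩ l).card < (J ∩ l).card
      · obtain ⟨e, heJ, heI⟩ := Finset.exists_mem_notMem_of_card_lt_card hlt
        obtain ⟨heJ, hel⟩ := Finset.mem_inter.1 heJ
        have heI' : e ∉ I := fun h => heI (Finset.mem_inter.2 ⟨h, hel⟩)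
        refine ⟨e, heJ, heI', ?_, ?_⟩
        · rw [Finset.insert_inter_of_mem hel]
          exact (Finset.card_insert_le _ _).trans (by have := hJ.1; omega)
        · rw [Finset.insert_sdiff_of_mem _ hel]
          exact hI.2
      · have hlt' : (I \ l).card < (J \ l).card := by omega
        obtain ⟨e, heJ, heI⟩ := Finset.exists_mem_notMem_of_card_lt_card hlt'
        obtain ⟨heJ, hel⟩ := Finset.mem_sdiff.1 heJ
        have heI' : e ∉ I := fun h => heI (Finset.mem_sdiff.2 ⟨h, hel⟩)
        refine ⟨e, heJ, heI', ?_, ?_⟩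
        · rw [Finset.insert_inter_of_notMem hel]
          exact hI.1
        · rw [Finset.insert_sdiff_of_notMem _ hel]
          exact (Finset.card_insert_le _ _).trans (by have := hJ.2; omega))
    (fun _ _ => Set.subset_univ _)).matroid

/-- The matroid `A_j`: the `j`-th line of the Fano plane, with the remaining four points coinciding
outside of this line. -/
def fanoA (j : Fin 7) : Matroid (Fin 7) := lineAndMultiplePoint (fanoLine j)

set_option maxRecDepth 20000 in
/-- The matroid `B_k`: for each of the three lines `{k, x, y}` through `k`, the points `x` and `y`
form a double point; the three double points lie on a common line and are otherwise generic on it,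
and `k` is a free point outside of this line. So a set is independent if and only if it has at most
two points different from `k` and contains none of the three double points `{x, y}`. -/
def fanoB (k : Fin 7) : Matroid (Fin 7) :=
  (IndepMatroid.ofFinset Set.univ
    (fun I : Finset (Fin 7) => (I.erase k).card ≤ 2 ∧
      ∀ x ∈ I, ∀ y ∈ I, x ≠ y → {k, x, y} ∉ fanoConfig.lines)
    (by simp)
    (fun I J hJ h => ⟨(Finset.card_le_card (Finset.erase_subset_erase k h)).trans hJ.1,
      fun x hx y hy => hJ.2 x (h hx) y (h hy)⟩)
    (fun I J hI hJ h => by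
      have htrans : ∀ k a x y : Fin 7, a ≠ x → a ≠ y → {k, a, x} ∈ fanoConfig.lines →
          {k, a, y} ∈ fanoConfig.lines → x = y := by decide
      have hnk : ∀ k x : Fin 7, ({k, x, k} : Finset (Fin 7)) ∉ fanoConfig.lines ∧
          ({k, k, x} : Finset (Fin 7)) ∉ fanoConfig.lines := by decide
      by_cases hk : k ∈ J ∧ k ∉ I
      · refine ⟨k, hk.1, hk.2, ?_, ?_⟩
        · rw [Finset.erase_insert_eq_erase]
          exact hI.1
        · intro x hx y hy hxy
          rcases Finset.mem_insert.1 hx with rfl | hx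
          · exact (hnk x y).2
          · rcases Finset.mem_insert.1 hy with rfl | hy
            · exact (hnk y x).1
            · exact hI.2 x hx y hy hxy
      · have hlt : (I.erase k).card < (J.erase k).card := by
          by_cases hkI : k ∈ I
          · have h1 := Finset.card_erase_add_one hkI
            have h2 := Finset.pred_card_le_card_erase (s := J) (a := k)
            omega
          · have hkJ : k ∉ J := fun h => hk ⟨h, hkI⟩
            rwa [Finset.erase_eq_of_notMem hkI, Finset.erase_eq_of_notMem hkJ]
        -- some point of `J` other than `k` is neither in `I` nor parallel to a point of `I`
        have key : ∃ e ∈ J.erase k, e ∉ I ∧ ∀ x ∈ I, {k, x, e} ∉ fanoConfig.lines := by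
          by_contra hc
          push Not at hc
          have hf : ∀ e ∈ J.erase k, ∃ x ∈ I.erase k,
              x = e ∨ (x ≠ e ∧ {k, x, e} ∈ fanoConfig.lines) := by
            intro e he
            by_cases heI : e ∈ I
            · exact ⟨e, Finset.mem_erase.2 ⟨(Finset.mem_erase.1 he).1, heI⟩, Or.inl rfl⟩
            · obtain ⟨x, hxI, hx⟩ := hc e he heI
              refine ⟨x, Finset.mem_erase.2 ⟨?_, hxI⟩, Or.inr ⟨?_, hx⟩⟩
              · rintro rfl
                exact (hnk x e).2 hx
              · rintro rfl
                exact heI hxI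
          choose! f hfI hf using hf
          obtain ⟨e, he, e', he', hne, hff⟩ :=
            Finset.exists_ne_map_eq_of_card_lt_of_maps_to hlt hfI
          have hJe := (Finset.mem_erase.1 he).2
          have hJe' := (Finset.mem_erase.1 he').2
          rcases hf e he with h1 | ⟨h1, h1'⟩ <;> rcases hf e' he' with h2 | ⟨h2, h2'⟩
          · exact hne (h1.symm.trans (hff.trans h2))
          · rw [← hff, h1] at h2'
            exact hJ.2 e hJe e' hJe' hne h2'
          · rw [hff, h2] at h1'
            exact hJ.2 e' hJe' e hJe hne.symm h1'
          · rw [← hff] at h2 h2'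
            exact hne (htrans k (f e) e e' h1 h2 h1' h2')
        obtain ⟨e, heJ, heI, he⟩ := key
        obtain ⟨hek, heJ⟩ := Finset.mem_erase.1 heJ
        refine ⟨e, heJ, heI, ?_, ?_⟩
        · rw [Finset.erase_insert_of_ne hek]
          exact (Finset.card_insert_le _ _).trans (by have := hJ.1; omega)
        · intro x hx y hy hxy
          rcases Finset.mem_insert.1 hx with hxe | hxI
          · rcases Finset.mem_insert.1 hy with hye | hyI
            · exact absurd (hxe.trans hye.symm) hxy
            · rw [hxe, Finset.pair_comm]
              exact he y hyI
          · rcases Finset.mem_insert.1 hy with hye | hyI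
            · rw [hye]
              exact he x hxI
            · exact hI.2 x hxI y hyI hxy)
    (fun _ _ => Set.subset_univ _)).matroid

/-! A configuration lies in the circuit variety exactly when the three vectors on each Fano line are
coplanar. If all seven vectors lie in one plane, the configuration belongs to the variety of
`U_{2,7}`. Suppose they span space. If the vector at `i` vanishes, the four lines avoiding `i` form
a complete quadrilateral whose six vertices are the other points, and degenerate quadrilaterals are
limits of parametrized ones (`mem_closure_range_fanoMap_makeLoop`). If no vector vanishes, two of
them are parallel, because the Fano plane is not representable in characteristic zero
(`exists_parallel_of_fano`). Propagating this coincidence along the lines leaves only the types `A`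
and `B` (`mem_range_fanoMap_of_parallel`).

Conversely, each of the 22 matroids has a polynomial parametrization `fanoMap` by a vector space.
Its image is irreducible, respects the dependencies, contains a realization, and is dense enough for
its closure to contain every realization; `matroidVariety_eq_closure` then identifies the closure
with the matroid variety. An inclusion of varieties would carry dependent sets of the larger one's
matroid to dependent sets of the smaller one's, which the finite check `exists_indep_not_indep`
excludes. A finite cover by closed irreducible sets without inclusions is the list of components
(`componentsOf_eq_range`). -/

/-! ### Polynomial curves and the Zariski topology -/

/-- A function `ℂ → ℂ` that is given by a polynomial. -/
def IsPolyFun (f : ℂ → ℂ) : Prop := ∃ p : Polynomial ℂ, ∀ t, f t = p.eval t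

namespace IsPolyFun

variable {f g : ℂ → ℂ}

lemma const (a : ℂ) : IsPolyFun fun _ => a := ⟨Polynomial.C a, by simp⟩

lemma id : IsPolyFun fun t => t := ⟨Polynomial.X, by simp⟩

lemma add (hf : IsPolyFun f) (hg : IsPolyFun g) : IsPolyFun fun t => f t + g t := by
  obtain ⟨p, hp⟩ := hf
  obtain ⟨q, hq⟩ := hg
  exact ⟨p + q, by simp [hp, hq]⟩

lemma sub (hf : IsPolyFun f) (hg : IsPolyFun g) : IsPolyFun fun t => f t - g t := by
  obtain ⟨p, hp⟩ := hf
  obtain ⟨q, hq⟩ := hg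
  exact ⟨p - q, by simp [hp, hq]⟩

lemma mul (hf : IsPolyFun f) (hg : IsPolyFun g) : IsPolyFun fun t => f t * g t := by
  obtain ⟨p, hp⟩ := hf
  obtain ⟨q, hq⟩ := hg
  exact ⟨p * q, by simp [hp, hq]⟩

lemma mvPolynomial_eval {σ : Type*} {c : ℂ → σ → ℂ} (hc : ∀ s, IsPolyFun fun t => c t s)
    (p : MvPolynomial σ ℂ) : IsPolyFun fun t => MvPolynomial.eval (c t) p := by
  induction p using MvPolynomial.induction_on with
  | C a => simpa using const a
  | add p q hp hq => simpa using hp.add hq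
  | mul_X p s hp => simpa using hp.mul (hc s)

/-- Two polynomial functions that do not vanish identically have a common nonzero. -/
lemma exists_ne_zero (hf : IsPolyFun f) (hg : IsPolyFun g) {a b : ℂ} (ha : f a ≠ 0)
    (hb : g b ≠ 0) : ∃ t, f t ≠ 0 ∧ g t ≠ 0 := by
  obtain ⟨p, hp⟩ := hf
  obtain ⟨q, hq⟩ := hg
  have hp0 : p ≠ 0 := by rintro rfl; simp [hp] at ha
  have hq0 : q ≠ 0 := by rintro rfl; simp [hq] at hb
  by_contra! h
  refine mul_ne_zero hp0 hq0 (Polynomial.funext fun t => ?_)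
  by_cases ht : f t = 0
  · simp [← hp, ht]
  · simp [← hq, h t ht]

end IsPolyFun

namespace VectorConfig

variable {n d : ℕ}

/-- A curve of vector configurations with polynomial coordinates. -/
def IsPolyCurve (c : ℂ → VectorConfig n d) : Prop := ∀ i j, IsPolyFun fun t => (c t).vec i j

lemma isClosed_iff {Z : Set (VectorConfig n d)} : IsClosed Z ↔ ∃ S, zeroSet S = Z := by
  rw [← isOpen_compl_iff]
  change Zᶜᶜ ∈ Set.range zeroSet ↔ _
  simp

lemma isOpen_ne_zero (p : MvPolynomial (Fin d × Fin n) ℂ) :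
    IsOpen {γ : VectorConfig n d | MvPolynomial.eval γ.coords p ≠ 0} := by
  rw [← isClosed_compl_iff, isClosed_iff]
  exact ⟨{p}, by ext; simp [zeroSet]⟩

lemma exists_ne_zero_of_isOpen {U : Set (VectorConfig n d)} (hU : IsOpen U) {γ : VectorConfig n d}
    (hγ : γ ∈ U) : ∃ p : MvPolynomial (Fin d × Fin n) ℂ, MvPolynomial.eval γ.coords p ≠ 0 ∧
      ∀ δ : VectorConfig n d, MvPolynomial.eval δ.coords p ≠ 0 → δ ∈ U := by
  obtain ⟨S, hS⟩ := isClosed_iff.1 hU.isClosed_compl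
  have h : γ ∉ zeroSet S := by rw [hS]; simpa using hγ
  simp only [zeroSet, Set.mem_ofPred_eq, not_forall] at h
  obtain ⟨p, hp, hne⟩ := h
  refine ⟨p, hne, fun δ hδ => ?_⟩
  by_contra hc
  have : δ ∈ zeroSet S := by rw [hS]; exact hc
  exact hδ (this p hp)

lemma IsPolyCurve.eval {c : ℂ → VectorConfig n d} (hc : IsPolyCurve c)
    (p : MvPolynomial (Fin d × Fin n) ℂ) :
    IsPolyFun fun t => MvPolynomial.eval (c t).coords p :=
  IsPolyFun.mvPolynomial_eval (c := fun t => (c t).coords) (fun s => hc s.1 s.2) p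

/-- The limit at `0` of a polynomial curve lies in the Zariski closure of its other points. -/
lemma IsPolyCurve.mem_closure {c : ℂ → VectorConfig n d} (hc : IsPolyCurve c)
    {Z : Set (VectorConfig n d)} (h : ∀ t ≠ 0, c t ∈ Z) : c 0 ∈ closure Z := by
  refine mem_closure_iff.2 fun U hU h0 => ?_
  obtain ⟨p, hp, hpU⟩ := exists_ne_zero_of_isOpen hU h0
  -- Pairing with the function `t` itself makes the common nonzero different from `0`.
  obtain ⟨t, ht, ht0⟩ := (hc.eval p).exists_ne_zero .id hp one_ne_zero
  exact ⟨c t, hpU _ ht, h t ht0⟩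

/-- The image of a vector space under a map that is polynomial along lines is irreducible. -/
lemma isIrreducible_range {E : Type*} [AddCommGroup E] [Module ℂ E] {F : E → VectorConfig n d}
    (hF : ∀ x y, IsPolyCurve fun t => F (x + t • y)) : IsIrreducible (Set.range F) := by
  refine ⟨Set.range_nonempty F, ?_⟩
  rintro U V hU hV ⟨_, ⟨x, rfl⟩, hx⟩ ⟨_, ⟨y, rfl⟩, hy⟩
  obtain ⟨p, hp, hpU⟩ := exists_ne_zero_of_isOpen hU hx
  obtain ⟨q, hq, hqV⟩ := exists_ne_zero_of_isOpen hV hy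
  -- Along the line from `x` to `y`, `p` is nonzero at `t = 0` and `q` at `t = 1`, so some parameter
  -- serves both.
  have hc := hF x (y - x)
  obtain ⟨t, ht, ht'⟩ := (hc.eval p).exists_ne_zero (hc.eval q) (a := 0) (b := 1)
    (by simpa using hp) (by simpa using hq)
  exact ⟨_, ⟨_, rfl⟩, hpU _ ht, hqV _ ht'⟩

/-- Linear independence of a subfamily is a Zariski open condition. -/
lemma isOpen_linearIndepOn (S : Set (Fin d)) :
    IsOpen {γ : VectorConfig n d | LinearIndepOn ℂ γ.vec S} := by
  classical
  -- Independence means that some linear map `A` to `ℂ^S` keeps the vectors independent, which is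
  -- the nonvanishing of one determinant. A left inverse of the linear combination map provides such
  -- an `A`, with determinant `1`.
  let P (A : Matrix S (Fin n) ℂ) : MvPolynomial (Fin d × Fin n) ℂ :=
    (Matrix.of fun s t : S => ∑ j, MvPolynomial.C (A t j) * MvPolynomial.X (s.1, j)).det
  have hP : ∀ A (γ : VectorConfig n d), MvPolynomial.eval γ.coords (P A) =
      (Matrix.of fun s t : S => A.mulVec (γ.vec s) t).det := by
    intro A γ
    rw [RingHom.map_det]
    congr 1
    ext s t
    simp [Matrix.mulVec, dotProduct, coords]
  have : {γ : VectorConfig n d | LinearIndepOn ℂ γ.vec S} =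
      ⋃ A, {γ : VectorConfig n d | MvPolynomial.eval γ.coords (P A) ≠ 0} := by
    ext γ
    simp only [Set.mem_iUnion, Set.mem_ofPred_eq, hP]
    constructor
    · intro h
      obtain ⟨B, hB⟩ := LinearMap.exists_leftInverse_of_injective
        (Fintype.linearCombination ℂ (fun s : S => γ.vec s))
        (LinearMap.ker_eq_bot.2 h.fintypeLinearCombination_injective)
      refine ⟨LinearMap.toMatrix' B, ?_⟩
      have : (Matrix.of fun s t : S => (LinearMap.toMatrix' B).mulVec (γ.vec s) t) = 1 := by
        ext s t
        have := congrFun (LinearMap.congr_fun hB (Pi.single s 1)) t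
        simp only [LinearMap.comp_apply, Fintype.linearCombination_apply_single, one_smul,
          LinearMap.id_apply] at this
        simp only [Matrix.of_apply, LinearMap.toMatrix'_mulVec, this, Matrix.one_apply,
          Pi.single_apply, eq_comm]
      rw [this]
      simp
    · rintro ⟨A, hA⟩
      have := Matrix.linearIndependent_rows_iff_isUnit.2
        ((Matrix.isUnit_iff_isUnit_det _).2 (isUnit_iff_ne_zero.2 hA))
      exact LinearIndependent.of_comp A.mulVecLin this
  rw [this]
  exact isOpen_iUnion fun A => isOpen_ne_zero _

end VectorConfig

/-! ### Circuit varieties and matroid varieties -/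

section Varieties

variable {n d : ℕ} {M N : Matroid (Fin d)}

lemma mem_circuitVariety_iff (hM : M.E = Set.univ) {γ : VectorConfig n d} :
    γ ∈ circuitVariety n M ↔ ∀ S, LinearIndepOn ℂ γ.vec S → M.Indep S := by
  refine forall_congr' fun S => ?_
  rw [← Matroid.not_indep_iff (by simp [hM])]
  tauto

lemma mem_realizationSpace_iff (hM : M.E = Set.univ) {γ : VectorConfig n d} :
    γ ∈ realizationSpace n M ↔ ∀ S, LinearIndepOn ℂ γ.vec S ↔ M.Indep S := by
  refine forall_congr' fun S => ?_
  rw [← Matroid.not_indep_iff (by simp [hM])]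
  tauto

lemma isClosed_circuitVariety : IsClosed (circuitVariety n M) := by
  have : circuitVariety n M =
      ⋂ S, ⋂ (_ : M.Dep S), {γ : VectorConfig n d | LinearIndepOn ℂ γ.vec S}ᶜ := by
    ext γ
    simp [circuitVariety]
  rw [this]
  exact isClosed_iInter fun S => isClosed_iInter fun _ =>
    (VectorConfig.isOpen_linearIndepOn S).isClosed_compl

lemma realizationSpace_subset_circuitVariety (h : ∀ S, N.Dep S → M.Dep S) :
    realizationSpace n M ⊆ circuitVariety n N :=
  fun _ hγ S hS => (hγ S).2 (h S hS)

lemma matroidVariety_subset_circuitVariety (h : ∀ S, N.Dep S → M.Dep S) :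
    matroidVariety n M ⊆ circuitVariety n N :=
  closure_minimal (realizationSpace_subset_circuitVariety h) isClosed_circuitVariety

/-- If the realizable matroid variety of `M` lies in that of `N`, then the dependent sets of `N`
are dependent in `M`. -/
lemma dep_of_matroidVariety_subset (hM : (realizationSpace n M).Nonempty)
    (h : matroidVariety n M ⊆ matroidVariety n N) {S : Set (Fin d)} (hS : N.Dep S) : M.Dep S := by
  obtain ⟨γ, hγ⟩ := hM
  exact (hγ S).1 (matroidVariety_subset_circuitVariety (fun _ h => h) (h (subset_closure hγ)) S hS)

/-- The matroid variety of `M` is the closure of any irreducible set of configurations that include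
the dependencies of `M`, provided that the set contains a realization and its closure contains all
of them. -/
lemma matroidVariety_eq_closure (hM : M.E = Set.univ) {Z : Set (VectorConfig n d)}
    (hZ : IsIrreducible Z) (hsub : Z ⊆ circuitVariety n M)
    (hne : (Z ∩ realizationSpace n M).Nonempty)
    (hsup : realizationSpace n M ⊆ closure Z) : matroidVariety n M = closure Z := by
  refine (closure_minimal hsup isClosed_closure).antisymm (closure_minimal ?_ isClosed_closure)
  -- On `U` no independent set of `M` degenerates, so `Z ∩ U` consists of realizations. Being open
  -- and nonempty in the irreducible `Z`, it is dense there.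
  let U : Set (VectorConfig n d) :=
    ⋂ S, ⋂ (_ : M.Indep S), {γ : VectorConfig n d | LinearIndepOn ℂ γ.vec S}
  have hU : IsOpen U := isOpen_iInter_of_finite fun S => isOpen_iInter_of_finite fun _ =>
    VectorConfig.isOpen_linearIndepOn S
  have hUR : Z ∩ U ⊆ realizationSpace n M := fun γ hγ => (mem_realizationSpace_iff hM).2 fun S =>
    ⟨(mem_circuitVariety_iff hM).1 (hsub hγ.1) S, fun hS => by
      have := hγ.2
      simp only [U, Set.mem_iInter] at this
      exact this S hS⟩
  obtain ⟨γ, hγZ, hγ⟩ := hne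
  refine fun δ hδ => closure_mono hUR (mem_closure_iff.2 fun V hV hδV => ?_)
  obtain ⟨ε, hε, hεV, hεU⟩ := hZ.2 V U hV hU ⟨δ, hδ, hδV⟩ ⟨γ, hγZ, by
    simp only [U, Set.mem_iInter]
    exact fun S hS => ((mem_realizationSpace_iff hM).1 hγ S).2 hS⟩
  exact ⟨ε, hεV, hε, hεU⟩

end Varieties

/-! ### Irreducible components of a finite union -/

/-- The components of a finite union of closed irreducible sets without inclusions between them. -/
lemma componentsOf_eq_range {X ι : Type*} [TopologicalSpace X] [Finite ι] {V : Set X} {Z : ι → Set X}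
    (hV : V = ⋃ i, Z i) (hc : ∀ i, IsClosed (Z i)) (hirr : ∀ i, IsIrreducible (Z i))
    (hZ : ∀ i j, Z i ⊆ Z j → i = j) : componentsOf V = Set.range Z := by
  have hsub : ∀ i, Z i ⊆ V := fun i => hV ▸ Set.subset_iUnion Z i
  -- An irreducible set covered by finitely many closed sets lies in one of them.
  have key : ∀ W : Set X, IsIrreducible W → W ⊆ V → ∃ i, W ⊆ Z i := by
    intro W hW hWV
    obtain ⟨_, hz, hWz⟩ := (isIrreducible_iff_sUnion_isClosed.1 hW)
      (Set.finite_range Z).toFinset (by simpa using hc) (by simpa [hV] using hWV)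
    obtain ⟨i, rfl⟩ : ∃ i, Z i = _ := by simpa using hz
    exact ⟨i, hWz⟩
  have himg : ∀ W : Set V, IsIrreducible W → IsIrreducible (Subtype.val '' W) := fun W hW =>
    hW.image _ continuous_subtype_val.continuousOn
  have hpre : ∀ i, IsIrreducible (Subtype.val ⁻¹' Z i : Set V) := by
    intro i
    obtain ⟨x, hx⟩ := (hirr i).1
    refine ⟨⟨⟨x, hsub i hx⟩, hx⟩, ?_⟩
    rintro U U' hU hU' ⟨y, hy, hyU⟩ ⟨z, hz, hzU⟩
    obtain ⟨O, hO, rfl⟩ := isOpen_induced_iff.1 hU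
    obtain ⟨O', hO', rfl⟩ := isOpen_induced_iff.1 hU'
    obtain ⟨w, hw, hwO⟩ := (hirr i).2 O O' hO hO' ⟨y, hy, hyU⟩ ⟨z, hz, hzU⟩
    exact ⟨⟨w, hsub i hw⟩, hw, hwO⟩
  ext W
  constructor
  · rintro ⟨C, hC, rfl⟩
    obtain ⟨i, hi⟩ := key _ (himg C hC.1) (by simp)
    have h := hC.2 (hpre i) (Set.image_subset_iff.1 hi)
    exact ⟨i, Set.Subset.antisymm (fun x hx => ⟨⟨x, hsub i hx⟩, h hx, rfl⟩) hi⟩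
  · rintro ⟨i, rfl⟩
    refine ⟨Subtype.val ⁻¹' Z i, ⟨hpre i, fun D hD hCD => ?_⟩, ?_⟩
    · obtain ⟨j, hj⟩ := key _ (himg D hD) (by simp)
      have hij : i = j := hZ i j fun x hx => hj ⟨⟨x, hsub i hx⟩, hCD hx, rfl⟩
      subst hij
      exact Set.image_subset_iff.1 hj
    · simpa using hsub i

/-! ### Vectors in three-space -/

section ThreeSpace

open Matrix

variable {u v w z L L' : Fin 3 → ℂ}

lemma fin_three_dotProduct (u v : Fin 3 → ℂ) : u ⬝ᵥ v = u 0 * v 0 + u 1 * v 1 + u 2 * v 2 := by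
  simp [dotProduct, Fin.sum_univ_three]

lemma exists_apply_ne_zero (h : v ≠ 0) : v 0 ≠ 0 ∨ v 1 ≠ 0 ∨ v 2 ≠ 0 := by
  by_contra! hc
  exact h (funext fun j => by fin_cases j <;> simp [hc])

/-- Every vector orthogonal to `L ≠ 0` is a cross product with `L`. -/
lemma exists_cross_eq (hL : L ≠ 0) (h : L ⬝ᵥ v = 0) : ∃ N, L ⨯₃ N = v := by
  rw [fin_three_dotProduct] at h
  rcases exists_apply_ne_zero hL with h0 | h0 | h0
  -- `N` is determined only up to multiples of `L`, so its coordinate at a nonzero entry of `L` may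
  -- be taken to be `0`.
  · refine ⟨![0, v 2 / L 0, -v 1 / L 0], funext fun j => ?_⟩
    fin_cases j <;> simp [cross_apply] <;> field_simp
    linear_combination -h
  · refine ⟨![-v 2 / L 1, 0, v 0 / L 1], funext fun j => ?_⟩
    fin_cases j <;> simp [cross_apply] <;> field_simp
    linear_combination -h
  · refine ⟨![v 1 / L 2, -v 0 / L 2, 0], funext fun j => ?_⟩
    fin_cases j <;> simp [cross_apply] <;> field_simp
    linear_combination -h

lemma exists_smul_of_cross_eq_zero (hu : u ≠ 0) (h : u ⨯₃ v = 0) : ∃ c : ℂ, v = c • u := by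
  have h0 := congrFun h 0
  have h1 := congrFun h 1
  have h2 := congrFun h 2
  simp only [cross_apply, Matrix.cons_val, Pi.zero_apply] at h0 h1 h2
  rcases exists_apply_ne_zero hu with hu | hu | hu
  · refine ⟨v 0 / u 0, funext fun j => ?_⟩
    fin_cases j <;> simp <;> field_simp
    · linear_combination h2
    · linear_combination -h1
  · refine ⟨v 1 / u 1, funext fun j => ?_⟩
    fin_cases j <;> simp <;> field_simp
    · linear_combination -h2
    · linear_combination h0
  · refine ⟨v 2 / u 2, funext fun j => ?_⟩
    fin_cases j <;> simp <;> field_simp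
    · linear_combination h1
    · linear_combination -h0

/-- A vector orthogonal to two linearly independent vectors is a multiple of their cross product. -/
lemma exists_smul_cross (hL : L ⨯₃ L' ≠ 0) (h : L ⬝ᵥ v = 0) (h' : L' ⬝ᵥ v = 0) :
    ∃ c : ℂ, v = c • (L ⨯₃ L') := by
  refine exists_smul_of_cross_eq_zero hL ?_
  rw [cross_cross_eq_smul_sub_smul, h, h']
  simp

/-- The three vectors lie in a common plane. -/
def Coplanar₃ (u v w : Fin 3 → ℂ) : Prop := ∃ L ≠ 0, L ⬝ᵥ u = 0 ∧ L ⬝ᵥ v = 0 ∧ L ⬝ᵥ w = 0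

lemma coplanar₃_iff_det : Coplanar₃ u v w ↔ (Matrix.of ![u, v, w]).det = 0 := by
  rw [← Matrix.exists_mulVec_eq_zero_iff]
  refine exists_congr fun L => and_congr_right fun _ => ?_
  simp [funext_iff, Fin.forall_fin_succ, dotProduct_comm L]

/-- The normal to two independent vectors is unique up to scale: `L` and the normal witnessing
coplanarity are both multiples of `u ⨯₃ v`. This is how membership in a plane spreads along Fano
lines. -/
lemma Coplanar₃.dotProduct_eq_zero (h : Coplanar₃ u v w) (huv : u ⨯₃ v ≠ 0) (hu : L ⬝ᵥ u = 0)
    (hv : L ⬝ᵥ v = 0) : L ⬝ᵥ w = 0 := by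
  obtain ⟨M, hM, h1, h2, h3⟩ := h
  obtain ⟨c, rfl⟩ := exists_smul_cross huv (by rwa [dotProduct_comm]) (by rwa [dotProduct_comm] : v ⬝ᵥ L = 0)
  obtain ⟨c', rfl⟩ := exists_smul_cross huv (by rwa [dotProduct_comm]) (by rwa [dotProduct_comm] : v ⬝ᵥ M = 0)
  have hc : c' ≠ 0 := by rintro rfl; simp at hM
  simp only [smul_dotProduct, smul_eq_mul, mul_eq_zero, hc, false_or] at h3 ⊢
  exact Or.inr h3

/-- If `z` and two vectors of a plane not containing `z` are linearly dependent, the two vectors are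
parallel. -/
lemma Coplanar₃.cross_eq_zero (h : Coplanar₃ u v z) (hu : L ⬝ᵥ u = 0) (hv : L ⬝ᵥ v = 0)
    (hz : L ⬝ᵥ z ≠ 0) : u ⨯₃ v = 0 := by
  by_contra hc
  exact hz (h.dotProduct_eq_zero hc hu hv)

lemma Coplanar₃.exists_eq_add (h : Coplanar₃ u v w) (huv : u ⨯₃ v ≠ 0) :
    ∃ a b : ℂ, w = a • u + b • v := by
  have hdep : ¬ LinearIndependent ℂ ![w, u, v] := by
    intro hli
    obtain ⟨L, hL, h1, h2, h3⟩ := h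
    have := Matrix.linearIndependent_rows_iff_isUnit (A := Matrix.of ![w, u, v]) |>.1 hli
    rw [Matrix.isUnit_iff_isUnit_det, isUnit_iff_ne_zero] at this
    exact this (coplanar₃_iff_det.1 ⟨L, hL, h3, h1, h2⟩)
  have hmem : w ∈ Submodule.span ℂ (Set.range ![u, v]) := by
    by_contra hc
    exact hdep (linearIndependent_finCons.2 ⟨crossProduct_ne_zero_iff_linearIndependent.1 huv, hc⟩)
  rw [Matrix.range_cons, Matrix.range_cons, Matrix.range_empty, Set.union_empty,
    Set.singleton_union, Submodule.mem_span_pair] at hmem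
  obtain ⟨a, b, h⟩ := hmem
  exact ⟨a, b, h.symm⟩

variable {d : ℕ} {γ : VectorConfig 3 d}

/-- The vectors indexed by `T` lie in a plane if and only if at most two of them are independent. -/
lemma exists_dotProduct_eq_zero_iff {T : Set (Fin d)} :
    (∃ L ≠ 0, ∀ x ∈ T, L ⬝ᵥ γ.vec x = 0) ↔
      ∀ S ⊆ T, LinearIndepOn ℂ γ.vec S → S.ncard ≤ 2 := by
  constructor
  · rintro ⟨L, hL, h⟩ S hST hS
    let φ : (Fin 3 → ℂ) →ₗ[ℂ] ℂ := dotProductBilin ℂ ℂ L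
    have hlt : Module.finrank ℂ (LinearMap.ker φ) < 3 := by
      have := Submodule.finrank_lt (s := LinearMap.ker φ) (fun htop => hL ?_)
      · simpa using this
      · ext j
        have : Pi.single j 1 ∈ LinearMap.ker φ := htop ▸ Submodule.mem_top
        simpa [φ] using this
    have hS' : LinearIndependent ℂ
        (fun s : S => (⟨γ.vec s, by simpa [φ] using h s (hST s.2)⟩ : LinearMap.ker φ)) :=
      LinearIndependent.of_comp (LinearMap.ker φ).subtype hS
    have := Fintype.ofFinite S
    have := hS'.fintype_card_le_finrank
    rw [← Nat.card_eq_fintype_card, Nat.card_coe_set_eq] at this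
    omega
  · intro h
    -- A maximal independent subfamily has at most two members, so its span is proper and is killed
    -- by a nonzero functional.
    obtain ⟨b, hbT, -, hspan, hb⟩ := exists_linearIndepOn_extension
      (linearIndepOn_empty ℂ γ.vec) (Set.empty_subset T)
    have hcard := h b hbT hb
    have hne : Submodule.span ℂ (γ.vec '' b) < ⊤ := by
      refine lt_top_iff_ne_top.2 fun htop => ?_
      have := Fintype.ofFinite b
      have h1 := finrank_span_eq_card hb
      rw [← Set.image_eq_range, htop, finrank_top, ← Nat.card_eq_fintype_card,
        Nat.card_coe_set_eq] at h1
      simp at h1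
      omega
    obtain ⟨φ, hφ, hle⟩ := Submodule.exists_le_ker_of_lt_top _ hne
    have hφL : ∀ v, φ v = (fun j => φ (Pi.single j 1)) ⬝ᵥ v := by
      intro v
      conv_lhs => rw [← Finset.univ_sum_single v]
      simp only [map_sum, dotProduct]
      refine Finset.sum_congr rfl fun j _ => ?_
      rw [← mul_one (v j), ← smul_eq_mul, Pi.single_smul, map_smul, smul_eq_mul, smul_eq_mul,
        mul_one, mul_comm]
    refine ⟨fun j => φ (Pi.single j 1), fun h0 => hφ ?_, fun x hx => ?_⟩
    · refine LinearMap.ext fun v => ?_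
      rw [hφL v, h0]
      simp
    · rw [← hφL]
      exact hle (hspan ⟨x, hx, rfl⟩)

lemma ncard_le_of_dotProduct_eq_zero {S : Set (Fin d)} (hS : LinearIndepOn ℂ γ.vec S) (hL : L ≠ 0)
    (h : ∀ x ∈ S, L ⬝ᵥ γ.vec x = 0) : S.ncard ≤ 2 :=
  exists_dotProduct_eq_zero_iff.1 ⟨L, hL, h⟩ S subset_rfl hS

lemma ncard_le_three {S : Set (Fin d)} (hS : LinearIndepOn ℂ γ.vec S) : S.ncard ≤ 3 := by
  have := Fintype.ofFinite S
  have := LinearIndependent.fintype_card_le_finrank hS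
  rw [← Nat.card_eq_fintype_card, Nat.card_coe_set_eq] at this
  simpa using this

lemma linearIndepOn_pair_iff_cross {x y : Fin d} (hxy : x ≠ y) :
    LinearIndepOn ℂ γ.vec {x, y} ↔ γ.vec x ⨯₃ γ.vec y ≠ 0 := by
  rw [crossProduct_ne_zero_iff_linearIndependent, LinearIndependent.pair_iff,
    LinearIndepOn.pair_iff _ hxy]

/-- Three vectors with nonzero determinant are linearly independent. -/
lemma linearIndepOn_of_det_ne_zero {S : Set (Fin d)} {x y z : Fin d} (hS : S ⊆ {x, y, z})
    (h : (Matrix.of ![γ.vec x, γ.vec y, γ.vec z]).det ≠ 0) : LinearIndepOn ℂ γ.vec S := by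
  have hli : LinearIndependent ℂ ![γ.vec x, γ.vec y, γ.vec z] :=
    Matrix.linearIndependent_rows_iff_isUnit.2
      ((Matrix.isUnit_iff_isUnit_det _).2 (isUnit_iff_ne_zero.2 h))
  have heq : ![γ.vec x, γ.vec y, γ.vec z] = γ.vec ∘ ![x, y, z] := by
    ext j
    fin_cases j <;> rfl
  rw [heq] at hli
  have := (linearIndepOn_range_iff hli.injective.of_comp _).2 hli
  refine this.mono fun t ht => ?_
  rcases hS ht with rfl | rfl | rfl
  · exact ⟨0, rfl⟩
  · exact ⟨1, rfl⟩
  · exact ⟨2, rfl⟩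

end ThreeSpace

/-! ### The independent sets of the matroids -/

section FanoMatroids

lemma uniformMatroid_indep_iff (I : Finset (Fin 7)) :
    (uniformMatroid 2 7).Indep I ↔ I.card ≤ 2 := by
  rw [uniformMatroid, IndepMatroid.matroid_Indep]
  erw [IndepMatroid.ofFinset_indep]

lemma fano_indep_iff (I : Finset (Fin 7)) :
    fano.Indep I ↔ I.card ≤ 3 ∧ ∀ j, ¬ fanoLine j ⊆ I := by
  have h : ∀ j, (fanoLine j).card = 3 := by decide
  rw [fano, PointLineConfig.matroid, IndepMatroid.matroid_Indep]
  erw [IndepMatroid.ofFinset_indep]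
  refine and_congr_right fun hI => ⟨fun hc j hj => ?_, fun hc h3 l hl hIl => ?_⟩
  · have heq := Finset.eq_of_subset_of_card_le hj (by rw [h]; exact hI)
    exact hc (heq ▸ h j) _ (Finset.mem_image_of_mem _ (Finset.mem_univ j)) heq.symm.subset
  · obtain ⟨j, -, rfl⟩ := Finset.mem_image.1 hl
    exact hc j (Finset.eq_of_subset_of_card_le hIl (by rw [h, h3])).symm.subset

lemma fano_makeLoop_indep_iff (i : Fin 7) (I : Finset (Fin 7)) :
    (fano.makeLoop i).Indep I ↔ (I.card ≤ 3 ∧ ∀ j, ¬ fanoLine j ⊆ I) ∧ i ∉ I := by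
  have hE : fano.E = Set.univ := rfl
  simp [Matroid.makeLoop, Matroid.restrict_indep_iff, hE, fano_indep_iff,
    Set.subset_compl_singleton_iff, ← Set.compl_eq_univ_sdiff]

lemma fanoA_indep_iff (j : Fin 7) (I : Finset (Fin 7)) :
    (fanoA j).Indep I ↔ (I ∩ fanoLine j).card ≤ 2 ∧ (I \ fanoLine j).card ≤ 1 := by
  rw [fanoA, lineAndMultiplePoint, IndepMatroid.matroid_Indep]
  erw [IndepMatroid.ofFinset_indep]

/-- Three points that lie on a common line of the Fano plane. -/
def FanoCollinear (x y z : Fin 7) : Prop :=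
  ∃ j, x ∈ fanoLine j ∧ y ∈ fanoLine j ∧ z ∈ fanoLine j

instance (x y z : Fin 7) : Decidable (FanoCollinear x y z) :=
  inferInstanceAs (Decidable (∃ j, x ∈ fanoLine j ∧ y ∈ fanoLine j ∧ z ∈ fanoLine j))

lemma mem_lines_iff : ∀ k x y : Fin 7, x ≠ y → ({k, x, y} ∈ fanoConfig.lines ↔
    x ≠ k ∧ y ≠ k ∧ FanoCollinear k x y) := by
  decide +kernel

lemma fanoB_indep_iff (k : Fin 7) (I : Finset (Fin 7)) :
    (fanoB k).Indep I ↔ (I.erase k).card ≤ 2 ∧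
      ∀ x ∈ I.erase k, ∀ y ∈ I.erase k, x ≠ y → ¬ FanoCollinear k x y := by
  rw [fanoB, IndepMatroid.matroid_Indep]
  erw [IndepMatroid.ofFinset_indep]
  refine and_congr_right fun _ => ⟨fun h x hx y hy hxy hc => ?_, fun h x hx y hy hxy hc => ?_⟩
  · rw [Finset.mem_erase] at hx hy
    exact h x hx.2 y hy.2 hxy ((mem_lines_iff k x y hxy).2 ⟨hx.1, hy.1, hc⟩)
  · obtain ⟨h1, h2, h3⟩ := (mem_lines_iff k x y hxy).1 hc
    exact h x (Finset.mem_erase.2 ⟨h1, hx⟩) y (Finset.mem_erase.2 ⟨h2, hy⟩) hxy h3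

/-- The matroids whose varieties are the components of the circuit variety of the Fano plane. -/
def fanoComponent : Unit ⊕ Fin 7 ⊕ Fin 7 ⊕ Fin 7 → Matroid (Fin 7) :=
  Sum.elim (fun _ => uniformMatroid 2 7) (Sum.elim fano.makeLoop (Sum.elim fanoA fanoB))

/-- The independent sets of the matroids `fanoComponent m`. -/
def FanoComponentIndep : Unit ⊕ Fin 7 ⊕ Fin 7 ⊕ Fin 7 → Finset (Fin 7) → Prop
  | .inl _, I => I.card ≤ 2
  | .inr (.inl i), I => (I.card ≤ 3 ∧ ∀ j, ¬ fanoLine j ⊆ I) ∧ i ∉ I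
  | .inr (.inr (.inl j)), I => (I ∩ fanoLine j).card ≤ 2 ∧ (I \ fanoLine j).card ≤ 1
  | .inr (.inr (.inr k)), I => (I.erase k).card ≤ 2 ∧
      ∀ x ∈ I.erase k, ∀ y ∈ I.erase k, x ≠ y → ¬ FanoCollinear k x y

instance : ∀ m I, Decidable (FanoComponentIndep m I)
  | .inl _, I => inferInstanceAs (Decidable (I.card ≤ 2))
  | .inr (.inl i), I => inferInstanceAs (Decidable ((I.card ≤ 3 ∧ ∀ j, ¬ fanoLine j ⊆ I) ∧ i ∉ I))
  | .inr (.inr (.inl j)), I =>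
    inferInstanceAs (Decidable ((I ∩ fanoLine j).card ≤ 2 ∧ (I \ fanoLine j).card ≤ 1))
  | .inr (.inr (.inr k)), I => inferInstanceAs (Decidable ((I.erase k).card ≤ 2 ∧
      ∀ x ∈ I.erase k, ∀ y ∈ I.erase k, x ≠ y → ¬ FanoCollinear k x y))

lemma fanoComponent_indep_iff : ∀ m (I : Finset (Fin 7)),
    (fanoComponent m).Indep I ↔ FanoComponentIndep m I
  | .inl _, I => uniformMatroid_indep_iff I
  | .inr (.inl i), I => fano_makeLoop_indep_iff i I
  | .inr (.inr (.inl j)), I => fanoA_indep_iff j I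
  | .inr (.inr (.inr k)), I => fanoB_indep_iff k I

lemma fanoComponent_ground (m) : (fanoComponent m).E = Set.univ := by
  rcases m with _ | _ | _ | _ <;> rfl

/-- This weak-order comparison with the Fano matroid places each of the varieties inside the circuit
variety. -/
lemma fanoComponentIndep_imp : ∀ m (I : Finset (Fin 7)), FanoComponentIndep m I →
    I.card ≤ 3 ∧ ∀ j, ¬ fanoLine j ⊆ I := by
  decide +kernel

/-- The matroids `fanoComponent m` are pairwise incomparable in the weak order. -/
lemma exists_indep_not_indep : ∀ m m', m ≠ m' → ∃ x y z : Fin 7,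
    FanoComponentIndep m {x, y, z} ∧ ¬ FanoComponentIndep m' {x, y, z} := by
  decide +kernel

end FanoMatroids

/-! ### Parametrizations of the components -/

section Parametrization

open Matrix

lemma IsPolyFun.affine (a b : ℂ) : IsPolyFun fun t => a + t * b := (const a).add (id.mul (const b))

lemma IsPolyFun.cross {u v : ℂ → Fin 3 → ℂ} (hu : ∀ k, IsPolyFun fun t => u t k)
    (hv : ∀ k, IsPolyFun fun t => v t k) (k : Fin 3) : IsPolyFun fun t => (u t ⨯₃ v t) k := by
  fin_cases k
  · simpa [cross_apply] using ((hu 1).mul (hv 2)).sub ((hu 2).mul (hv 1))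
  · simpa [cross_apply] using ((hu 2).mul (hv 0)).sub ((hu 0).mul (hv 2))
  · simpa [cross_apply] using ((hu 0).mul (hv 1)).sub ((hu 1).mul (hv 0))

/-- The first line of the Fano plane through `x` that does not contain `i`. -/
def fanoFst (i x : Fin 7) : Fin 7 :=
  ((List.finRange 7).find? fun j => x ∈ fanoLine j ∧ i ∉ fanoLine j).getD 0

/-- The last line of the Fano plane through `x` that does not contain `i`. -/
def fanoSnd (i x : Fin 7) : Fin 7 :=
  ((List.finRange 7).reverse.find? fun j => x ∈ fanoLine j ∧ i ∉ fanoLine j).getD 0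

/-- A line of the Fano plane through `k` and `x`. -/
def fanoJoin (k x : Fin 7) : Fin 7 :=
  ((List.finRange 7).find? fun j => x ∈ fanoLine j ∧ k ∈ fanoLine j).getD 0

/-- The parameters for vector configurations of the matroids `fanoComponent m`. -/
abbrev FanoParam : Type := (Fin 7 → Fin 3 → ℂ) × (Fin 7 → Fin 3 → ℂ) × (Fin 7 → ℂ)

/-- A parametrization of a dense subset of the matroid variety of `fanoComponent m`. -/
def fanoMap : Unit ⊕ Fin 7 ⊕ Fin 7 ⊕ Fin 7 → FanoParam → VectorConfig 3 7
  | .inl _, p => fun x => p.1 0 ⨯₃ p.2.1 x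
  | .inr (.inl i), p => fun x =>
    if x = i then 0 else p.2.2 x • (p.1 (fanoFst i x) ⨯₃ p.1 (fanoSnd i x))
  | .inr (.inr (.inl j)), p => fun x =>
    if x ∈ fanoLine j then p.1 0 ⨯₃ p.2.1 x else p.2.2 x • p.1 1
  | .inr (.inr (.inr k)), p => fun x =>
    if x = k then p.1 1 else p.2.2 x • (p.1 0 ⨯₃ p.2.1 (fanoJoin k x))

lemma isIrreducible_range_fanoMap (m) : IsIrreducible (Set.range (fanoMap m)) := by
  refine VectorConfig.isIrreducible_range fun p q x k => ?_
  have h1 : ∀ j k, IsPolyFun fun t => (p + t • q).1 j k := fun j k => .affine _ _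
  have h2 : ∀ j k, IsPolyFun fun t => (p + t • q).2.1 j k := fun j k => .affine _ _
  have h3 : ∀ j, IsPolyFun fun t => (p + t • q).2.2 j := fun j => .affine _ _
  rcases m with _ | i | j | i
  · exact .cross (h1 _) (h2 _) k
  · by_cases h : x = i
    · simpa [fanoMap, VectorConfig.vec, h] using IsPolyFun.const 0
    · simpa [fanoMap, VectorConfig.vec, h] using (h3 x).mul (.cross (h1 _) (h1 _) k)
  · by_cases h : x ∈ fanoLine j
    · simpa [fanoMap, VectorConfig.vec, h] using IsPolyFun.cross (h1 0) (h2 x) k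
    · simpa [fanoMap, VectorConfig.vec, h] using (h3 x).mul (h1 1 k)
  · by_cases h : x = i
    · simpa [fanoMap, VectorConfig.vec, h] using h1 1 k
    · simpa [fanoMap, VectorConfig.vec, h] using (h3 x).mul (.cross (h1 0) (h2 (fanoJoin i x)) k)

/-! #### The parametrized configurations include the dependencies -/

/-- The parameters of `fanoMap` are arbitrary, so a normal `L` may be zero; the products then vanish
and any nonzero `M` works. -/
lemma exists_dotProduct_cross_eq_zero (L : Fin 3 → ℂ) : ∃ M ≠ 0, ∀ v, M ⬝ᵥ (L ⨯₃ v) = 0 := by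
  by_cases hL : L = 0
  · exact ⟨1, one_ne_zero, by simp [hL]⟩
  · exact ⟨L, hL, dot_self_cross L⟩

/-- Of the three Fano lines through `x`, exactly one passes through `i`; the other two are the sides
of the quadrilateral meeting at `x`. -/
lemma fanoFst_fanoSnd : ∀ i x : Fin 7, x ≠ i → i ∉ fanoLine (fanoFst i x) ∧
    i ∉ fanoLine (fanoSnd i x) ∧ x ∈ fanoLine (fanoFst i x) ∧ x ∈ fanoLine (fanoSnd i x) ∧
    fanoFst i x ≠ fanoSnd i x := by
  decide +kernel

lemma eq_fanoFst_or_eq_fanoSnd : ∀ i x j : Fin 7, x ∈ fanoLine j → i ∉ fanoLine j →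
    j = fanoFst i x ∨ j = fanoSnd i x := by
  decide +kernel

lemma fanoJoin_eq : ∀ k x y : Fin 7, x ≠ k → y ≠ k → FanoCollinear k x y →
    fanoJoin k x = fanoJoin k y := by
  decide +kernel

lemma fanoLine_card : ∀ j, (fanoLine j).card = 3 := by decide

lemma fanoMap_mem_circuitVariety (m) (p : FanoParam) :
    fanoMap m p ∈ circuitVariety 3 (fanoComponent m) := by
  refine (mem_circuitVariety_iff (fanoComponent_ground m)).2 fun S hS => ?_
  lift S to Finset (Fin 7) using S.toFinite with I
  rw [fanoComponent_indep_iff]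
  have h3 := ncard_le_three hS
  rw [Set.ncard_coe_finset] at h3
  have hplane : ∀ J ⊆ I, (∃ L ≠ 0, ∀ x ∈ J, L ⬝ᵥ (fanoMap m p).vec x = 0) → J.card ≤ 2 := by
    rintro J hJ ⟨L, hL, h⟩
    rw [← Set.ncard_coe_finset]
    exact ncard_le_of_dotProduct_eq_zero (hS.mono (Finset.coe_subset.2 hJ)) hL h
  have hpair : ∀ x ∈ I, ∀ y ∈ I, x ≠ y → (fanoMap m p).vec x ⨯₃ (fanoMap m p).vec y ≠ 0 := by
    intro x hx y hy hxy
    exact (linearIndepOn_pair_iff_cross hxy).1 (hS.mono (by simp [Set.insert_subset_iff, hx, hy]))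
  obtain ⟨M, hM, hMc⟩ := exists_dotProduct_cross_eq_zero (p.1 0)
  rcases m with _ | i | j | k
  · exact hplane I subset_rfl ⟨M, hM, fun x _ => hMc _⟩
  · have hi : i ∉ I := fun hi => hS.ne_zero hi (by simp [fanoMap, VectorConfig.vec])
    refine ⟨⟨h3, fun j hj => ?_⟩, hi⟩
    have hij : i ∉ fanoLine j := fun h => hi (hj h)
    have hx : ∀ x ∈ fanoLine j, x ≠ i := fun x hx h => hij (h ▸ hx)
    obtain ⟨M, hM, hMc⟩ := exists_dotProduct_cross_eq_zero (p.1 j)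
    have := hplane _ hj ⟨M, hM, fun x hxj => ?_⟩
    · rw [fanoLine_card] at this
      omega
    · simp only [fanoMap, VectorConfig.vec, hx x hxj, if_false, dotProduct_smul]
      -- The normal of line `j` is one of the two factors of the cross product defining the vector
      -- at `x`.
      rcases eq_fanoFst_or_eq_fanoSnd i x j hxj hij with h | h
      · rw [← h, hMc, smul_zero]
      · rw [← h, ← cross_anticomm, dotProduct_neg, hMc, neg_zero, smul_zero]
  · refine ⟨hplane _ Finset.inter_subset_left ⟨M, hM, fun x hx => ?_⟩,
      Finset.card_le_one.2 fun x hx y hy => ?_⟩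
    · simp [fanoMap, VectorConfig.vec, (Finset.mem_inter.1 hx).2, hMc]
    · by_contra hxy
      rw [Finset.mem_sdiff] at hx hy
      exact hpair x hx.1 y hy.1 hxy (by simp [fanoMap, VectorConfig.vec, hx.2, hy.2])
  · refine ⟨hplane _ (Finset.erase_subset _ _) ⟨M, hM, fun x hx => ?_⟩,
      fun x hx y hy hxy hc => ?_⟩
    · simp [fanoMap, VectorConfig.vec, (Finset.mem_erase.1 hx).1, hMc]
    · rw [Finset.mem_erase] at hx hy
      exact hpair x hx.2 y hy.2 hxy
        (by simp [fanoMap, VectorConfig.vec, hx.1, hy.1, fanoJoin_eq k x y hx.1 hy.1 hc])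

/-! #### Realizations -/

/-- Integral realizations of the matroids `fanoComponent m`. -/
def fanoPoint : Unit ⊕ Fin 7 ⊕ Fin 7 ⊕ Fin 7 → Fin 7 → Fin 3 → ℤ
  | .inl _, x => ![1, x.val, 0]
  | .inr (.inl i), x => if x = i then 0 else
    let a : ℤ := (fanoFst i x).val
    let b : ℤ := (fanoSnd i x).val
    ![a * b ^ 2 - a ^ 2 * b, a ^ 2 - b ^ 2, b - a]
  | .inr (.inr (.inl j)), x => if x ∈ fanoLine j then ![1, x.val, 0] else ![0, 0, 1]
  | .inr (.inr (.inr k)), x => if x = k then ![0, 0, 1] else ![1, (fanoJoin k x).val, 0]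

lemma exists_fanoMap_eq_fanoPoint (m) : ∃ p, ∀ x, fanoMap m p x = fun l => (fanoPoint m x l : ℂ) := by
  -- Since `(0,0,1) ⨯₃ (x,-1,0) = (1,x,0)`, this gives distinct directions in a plane, with
  -- `(0,0,1)` also the vector off it.
  let p : FanoParam := (fun _ => ![0, 0, 1], fun x => ![x.val, -1, 0], fun _ => 1)
  rcases m with _ | i | j | k
  · refine ⟨p, fun x => funext fun l => ?_⟩
    fin_cases l <;> simp [p, fanoMap, fanoPoint, cross_apply]
  -- Normals on the moment curve put the four lines in general position.
  · refine ⟨(fun j => ![1, j.val, (j.val : ℂ) ^ 2], 0, fun _ => 1), fun x => funext fun l => ?_⟩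
    by_cases hx : x = i
    · simp [fanoMap, fanoPoint, hx]
    · fin_cases l <;> simp [fanoMap, fanoPoint, cross_apply, hx]
  · refine ⟨p, fun x => funext fun l => ?_⟩
    by_cases hx : x ∈ fanoLine j <;> fin_cases l <;>
      simp [p, fanoMap, fanoPoint, cross_apply, hx]
  · refine ⟨p, fun x => funext fun l => ?_⟩
    by_cases hx : x = k <;> fin_cases l <;> simp [p, fanoMap, fanoPoint, cross_apply, hx]

/-- The determinant of three integral vectors. -/
def detInt (u v w : Fin 3 → ℤ) : ℤ :=
  u 0 * (v 1 * w 2 - v 2 * w 1) - u 1 * (v 0 * w 2 - v 2 * w 0) + u 2 * (v 0 * w 1 - v 1 * w 0)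

lemma exists_detInt_fanoPoint_ne_zero : ∀ m (I : Finset (Fin 7)), FanoComponentIndep (.inr m) I →
    ∃ x y z, I ⊆ {x, y, z} ∧
      detInt (fanoPoint (.inr m) x) (fanoPoint (.inr m) y) (fanoPoint (.inr m) z) ≠ 0 := by
  decide +kernel

lemma exists_subset_pair : ∀ I : Finset (Fin 7), I.card ≤ 2 → ∃ x y, x ≠ y ∧ I ⊆ {x, y} := by
  decide +kernel

lemma exists_fanoMap_mem_realizationSpace (m) :
    (Set.range (fanoMap m) ∩ realizationSpace 3 (fanoComponent m)).Nonempty := by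
  obtain ⟨p, hp⟩ := exists_fanoMap_eq_fanoPoint m
  refine ⟨_, ⟨p, rfl⟩, (mem_realizationSpace_iff (fanoComponent_ground m)).2 fun S => ⟨?_, ?_⟩⟩
  · exact (mem_circuitVariety_iff (fanoComponent_ground m)).1 (fanoMap_mem_circuitVariety m p) S
  · lift S to Finset (Fin 7) using S.toFinite with I
    rw [fanoComponent_indep_iff]
    intro hI
    rcases m with _ | m
    -- Rank two has no nonzero `3 × 3` determinant to use; the last coordinate of a cross product of
    -- two of the vectors is a difference of labels.
    · obtain ⟨x, y, hxy, hsub⟩ := exists_subset_pair I hI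
      refine LinearIndepOn.mono ((linearIndepOn_pair_iff_cross hxy).2 fun h => hxy ?_)
        (by simpa using Finset.coe_subset.2 hsub)
      have := congrFun h 2
      simp [VectorConfig.vec, hp, fanoPoint, cross_apply, sub_eq_zero] at this
      exact Fin.ext this.symm
    · obtain ⟨x, y, z, hsub, hdet⟩ := exists_detInt_fanoPoint_ne_zero m I hI
      refine linearIndepOn_of_det_ne_zero (by simpa using Finset.coe_subset.2 hsub) fun h => hdet ?_
      have : ((detInt (fanoPoint (.inr m) x) (fanoPoint (.inr m) y) (fanoPoint (.inr m) z) : ℤ) : ℂ)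
          = 0 := by
        rw [← h, Matrix.det_fin_three]
        simp only [detInt, VectorConfig.vec, hp]
        push_cast
        simp
        ring
      exact_mod_cast this

end Parametrization

/-! ### Configurations in the closures of the parametrized sets -/

section Covering

open Matrix

variable {γ : VectorConfig 3 7}

lemma mem_range_fanoMap_uniform (h : ∃ L ≠ 0, ∀ x, L ⬝ᵥ γ.vec x = 0) :
    γ ∈ Set.range (fanoMap (.inl ())) := by
  obtain ⟨L, hL, h⟩ := h
  choose w hw using fun x => exists_cross_eq hL (h x)
  exact ⟨(fun _ => L, w, 0), funext hw⟩

lemma mem_range_fanoMap_A {j : Fin 7} (h : ∃ L ≠ 0, ∀ x ∈ fanoLine j, L ⬝ᵥ γ.vec x = 0)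
    (h' : ∃ v, ∀ x ∉ fanoLine j, ∃ c : ℂ, γ.vec x = c • v) :
    γ ∈ Set.range (fanoMap (.inr (.inr (.inl j)))) := by
  obtain ⟨L, hL, h⟩ := h
  obtain ⟨v, hv⟩ := h'
  have h1 : ∀ x, ∃ w, x ∈ fanoLine j → L ⨯₃ w = γ.vec x := fun x => by
    by_cases hx : x ∈ fanoLine j
    · exact (exists_cross_eq hL (h x hx)).imp fun w hw _ => hw
    · exact ⟨0, fun hx' => absurd hx' hx⟩
  have h2 : ∀ x, ∃ c : ℂ, x ∉ fanoLine j → γ.vec x = c • v := fun x => by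
    by_cases hx : x ∈ fanoLine j
    · exact ⟨0, fun hx' => absurd hx hx'⟩
    · exact (hv x hx).imp fun w hw _ => hw
  choose w hw using h1
  choose c hc using h2
  refine ⟨(![L, v, 0, 0, 0, 0, 0], w, c), funext fun x => ?_⟩
  by_cases hx : x ∈ fanoLine j
  · simp only [fanoMap, hx, if_true]
    exact hw x hx
  · simp only [fanoMap, hx, if_false]
    exact (hc x hx).symm

/-- Pairwise parallel vectors are multiples of a common vector: zero, or one of them. -/
lemma exists_forall_eq_smul {T : Set (Fin 7)}
    (h : ∀ x ∈ T, ∀ y ∈ T, x ≠ y → γ.vec x ⨯₃ γ.vec y = 0) :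
    ∃ v, (v = 0 ∨ ∃ x ∈ T, v = γ.vec x) ∧ ∀ x ∈ T, ∃ c : ℂ, γ.vec x = c • v := by
  by_cases h0 : ∀ x ∈ T, γ.vec x = 0
  · exact ⟨0, .inl rfl, fun x hx => ⟨0, by simp [h0 x hx]⟩⟩
  · push Not at h0
    obtain ⟨x, hx, hne⟩ := h0
    refine ⟨γ.vec x, .inr ⟨x, hx, rfl⟩, fun y hy => ?_⟩
    by_cases hxy : x = y
    · exact ⟨1, by simp [hxy]⟩
    · exact exists_smul_of_cross_eq_zero hne (h x hx y hy hxy)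

lemma fanoJoin_spec : ∀ k x, k ∈ fanoLine (fanoJoin k x) ∧ x ∈ fanoLine (fanoJoin k x) := by
  decide +kernel

lemma mem_range_fanoMap_B {k : Fin 7} (h : ∃ L ≠ 0, ∀ x ≠ k, L ⬝ᵥ γ.vec x = 0)
    (h' : ∀ x y, x ≠ k → y ≠ k → x ≠ y → FanoCollinear k x y → γ.vec x ⨯₃ γ.vec y = 0) :
    γ ∈ Set.range (fanoMap (.inr (.inr (.inr k)))) := by
  obtain ⟨L, hL, h⟩ := h
  have h1 : ∀ j, ∃ w, ∀ x, x ≠ k → fanoJoin k x = j → ∃ c : ℂ, γ.vec x = c • (L ⨯₃ w) := by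
    intro j
    obtain ⟨v, hv, hvc⟩ := exists_forall_eq_smul (γ := γ) (T := {x | x ≠ k ∧ fanoJoin k x = j}) (by
      rintro x ⟨hx, rfl⟩ y ⟨hy, hy'⟩ hxy
      have := (fanoJoin_spec k y).2
      rw [hy'] at this
      exact h' x y hx hy hxy ⟨_, (fanoJoin_spec k x).1, (fanoJoin_spec k x).2, this⟩)
    -- The common direction is zero or one of the vectors themselves, so it stays in the plane and
    -- is a cross product with `L`.
    have hLv : L ⬝ᵥ v = 0 := by
      rcases hv with rfl | ⟨x, hx, rfl⟩
      · simp
      · exact h x hx.1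
    obtain ⟨w, rfl⟩ := exists_cross_eq hL hLv
    exact ⟨w, fun x hx hxj => hvc x ⟨hx, hxj⟩⟩
  choose w hw using h1
  have h2 : ∀ x, ∃ c : ℂ, x ≠ k → γ.vec x = c • (L ⨯₃ w (fanoJoin k x)) := fun x => by
    by_cases hx : x = k
    · exact ⟨0, fun hx' => absurd hx hx'⟩
    · exact (hw _ x hx rfl).imp fun c hc _ => hc
  choose c hc using h2
  refine ⟨(![L, γ.vec k, 0, 0, 0, 0, 0], w, c), funext fun x => ?_⟩
  by_cases hx : x = k
  · subst hx
    simp [fanoMap, VectorConfig.vec]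
  · simp only [fanoMap, hx, if_false]
    exact (hc x hx).symm

/-! #### Configurations with a loop -/

/-- Each vertex of the quadrilateral lies on two of its four sides, so omitting one side still
leaves one through it. -/
lemma mem_of_three_lines : ∀ i a b c x : Fin 7, a ≠ b → a ≠ c → b ≠ c → i ∉ fanoLine a →
    i ∉ fanoLine b → i ∉ fanoLine c → x ≠ i → x ∈ fanoLine a ∨ x ∈ fanoLine b ∨ x ∈ fanoLine c := by
  decide +kernel

lemma eq_of_fanoFst_eq_of_fanoSnd_eq : ∀ i x y : Fin 7, x ≠ i → y ≠ i →
    fanoFst i x = fanoFst i y → fanoSnd i x = fanoSnd i y → x = y := by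
  decide +kernel

/-- For points other than `i`, `fanoFst` has a smaller index than `fanoSnd`, so the two cannot be
exchanged. -/
lemma fanoFst_ne_fanoSnd : ∀ i x y : Fin 7, x ≠ i → y ≠ i →
    fanoSnd i x = fanoFst i y → fanoFst i x ≠ fanoSnd i y := by
  decide +kernel

/-- A vertex whose two sides have independent normals is a multiple of their cross product. Trouble
arises only at vertices with parallel normals. Three parallel normals would force rank two, so the
parallel pairs are disjoint and each can be separated independently: moving one normal by `t • N`
with `L ⨯₃ N = γ.vec x` makes the cross product a multiple of `γ.vec x`, nonzero times `t`, and
rescaling recovers `γ.vec x` for every `t ≠ 0`. -/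
lemma mem_closure_range_fanoMap_makeLoop {i : Fin 7} (hi : γ.vec i = 0)
    (hline : ∀ j, i ∉ fanoLine j → ∃ L ≠ 0, ∀ x ∈ fanoLine j, L ⬝ᵥ γ.vec x = 0)
    (hrank : ¬ ∃ L ≠ 0, ∀ x, L ⬝ᵥ γ.vec x = 0) :
    γ ∈ closure (Set.range (fanoMap (.inr (.inl i)))) := by
  classical
  have h1 : ∀ j, ∃ L : Fin 3 → ℂ, i ∉ fanoLine j → L ≠ 0 ∧ ∀ x ∈ fanoLine j, L ⬝ᵥ γ.vec x = 0 := by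
    intro j
    by_cases hj : i ∈ fanoLine j
    · exact ⟨0, fun h => absurd hj h⟩
    · exact (hline j hj).imp fun L hL _ => hL
  choose L hL using h1
  -- no three of the chosen normal vectors are parallel
  have hthree : ∀ a b c, a ≠ b → a ≠ c → b ≠ c → i ∉ fanoLine a → i ∉ fanoLine b →
      i ∉ fanoLine c → L b ⨯₃ L a = 0 → L b ⨯₃ L c = 0 → False := by
    intro a b c hab hac hbc ha hb hc h h'
    have key : ∀ d, i ∉ fanoLine d → L b ⨯₃ L d = 0 → ∀ x ∈ fanoLine d, L b ⬝ᵥ γ.vec x = 0 := by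
      intro d hd hbd x hx
      obtain ⟨s, hs⟩ := exists_smul_of_cross_eq_zero (hL b hb).1 hbd
      have hs0 : s ≠ 0 := by
        rintro rfl
        exact (hL d hd).1 (by simpa using hs)
      have := (hL d hd).2 x hx
      rw [hs, smul_dotProduct, smul_eq_mul, mul_eq_zero] at this
      exact this.resolve_left hs0
    refine hrank ⟨L b, (hL b hb).1, fun x => ?_⟩
    by_cases hx : x = i
    · rw [hx, hi, dotProduct_zero]
    rcases mem_of_three_lines i a b c x hab hac hbc ha hb hc hx with hx | hx | hx
    · exact key a ha h x hx
    · exact (hL b hb).2 x hx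
    · exact key c hc h' x hx
  let par (x : Fin 7) : Prop := L (fanoSnd i x) ⨯₃ L (fanoFst i x) = 0
  have hpar_symm : ∀ x, par x → L (fanoFst i x) ⨯₃ L (fanoSnd i x) = 0 := fun x hx => by
    rw [← cross_anticomm, hx, neg_zero]
  -- a direction in which to move the normal vector of a line away from a parallel one
  have h2 : ∀ b, ∃ N : Fin 3 → ℂ, (∀ x, x ≠ i → fanoSnd i x = b → par x → L b ⨯₃ N = γ.vec x) ∧
      ((¬ ∃ x, x ≠ i ∧ fanoSnd i x = b ∧ par x) → N = 0) := by
    intro b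
    by_cases hb : ∃ x, x ≠ i ∧ fanoSnd i x = b ∧ par x
    · obtain ⟨x, hx, rfl, hpx⟩ := hb
      obtain ⟨f1, f2, f3, f4, f5⟩ := fanoFst_fanoSnd i x hx
      obtain ⟨N, hN⟩ := exists_cross_eq (hL _ f2).1 ((hL _ f2).2 x f4)
      refine ⟨N, fun y hy hyx hpy => ?_, fun h => absurd ⟨x, hx, rfl, hpx⟩ h⟩
      obtain ⟨g1, g2, g3, g4, g5⟩ := fanoFst_fanoSnd i y hy
      by_cases hf : fanoFst i x = fanoFst i y
      · rw [← eq_of_fanoFst_eq_of_fanoSnd_eq i x y hx hy hf hyx.symm, hN]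
      · simp only [par, hyx] at hpy
        exact (hthree _ _ _ f5 hf (hyx ▸ g5.symm) f1 f2 g1 hpx hpy).elim
    · exact ⟨0, fun x hx hxb hpx => absurd ⟨x, hx, hxb, hpx⟩ hb, fun _ => rfl⟩
  choose N hN hN0 using h2
  have h3 : ∀ x, ∃ s : ℂ, x ≠ i →
      if par x then s ≠ 0 ∧ L (fanoFst i x) = s • L (fanoSnd i x) ∧ N (fanoFst i x) = 0
      else γ.vec x = s • (L (fanoFst i x) ⨯₃ L (fanoSnd i x)) := by
    intro x
    by_cases hx : x = i
    · exact ⟨0, fun h => absurd hx h⟩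
    obtain ⟨f1, f2, f3, f4, f5⟩ := fanoFst_fanoSnd i x hx
    by_cases hp : par x
    · obtain ⟨s, hs⟩ := exists_smul_of_cross_eq_zero (hL _ f2).1 hp
      refine ⟨s, fun _ => ?_⟩
      rw [if_pos hp]
      refine ⟨?_, hs, hN0 _ ?_⟩
      · rintro rfl
        exact (hL _ f1).1 (by simpa using hs)
      · rintro ⟨y, hy, hyx, hpy⟩
        obtain ⟨g1, g2, g3, g4, g5⟩ := fanoFst_fanoSnd i y hy
        simp only [par, hyx] at hpy
        exact hthree _ _ _ (hyx ▸ g5) (fanoFst_ne_fanoSnd i y x hy hx hyx) f5 g1 f1 f2 hpy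
          (hpar_symm x hp)
    · obtain ⟨s, hs⟩ := exists_smul_cross (fun h => hp (by simp only [par]; rw [← cross_anticomm, h, neg_zero]))
        ((hL _ f1).2 x f3) ((hL _ f2).2 x f4)
      exact ⟨s, fun _ => by rwa [if_neg hp]⟩
  choose s hs using h3
  -- Vertices with parallel sides stay constant; the rescaling by `(s x * t)⁻¹` is confined to the
  -- parameters, so the curve itself is polynomial.
  let c : ℂ → VectorConfig 3 7 := fun t x =>
    if x = i then 0 else if par x then γ.vec x else
      s x • ((L (fanoFst i x) + t • N (fanoFst i x)) ⨯₃ (L (fanoSnd i x) + t • N (fanoSnd i x)))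
  have hc : VectorConfig.IsPolyCurve c := by
    intro x k
    by_cases hx : x = i
    · simpa [c, VectorConfig.vec, hx] using IsPolyFun.const 0
    by_cases hp : par x
    · simpa [c, VectorConfig.vec, hx, hp] using IsPolyFun.const (γ x k)
    · have := (IsPolyFun.const (s x)).mul (IsPolyFun.cross
        (u := fun t => L (fanoFst i x) + t • N (fanoFst i x))
        (v := fun t => L (fanoSnd i x) + t • N (fanoSnd i x))
        (fun k => .affine _ _) (fun k => .affine _ _) k)
      simpa only [c, VectorConfig.vec, hx, hp, if_false, Pi.smul_apply, smul_eq_mul] using this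
  have hc0 : c 0 = γ := by
    funext x
    by_cases hx : x = i
    · simp only [c, hx, if_true]
      exact hi.symm
    have h := hs x hx
    by_cases hp : par x
    · simp only [c, hx, hp, if_true, if_false]
      rfl
    · rw [if_neg hp] at h
      simp only [c, hx, hp, if_false, zero_smul, add_zero]
      exact h.symm
  rw [← hc0]
  refine hc.mem_closure fun t ht => ?_
  refine ⟨(fun j => L j + t • N j, 0, fun x => if par x then (s x * t)⁻¹ else s x),
    funext fun x => ?_⟩
  by_cases hx : x = i
  · simp [fanoMap, c, hx]
  have h := hs x hx
  by_cases hp : par x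
  · rw [if_pos hp] at h
    obtain ⟨h0, h1, h2⟩ := h
    simp only [fanoMap, c, hx, hp, if_true, if_false, h2, smul_zero, add_zero]
    rw [h1, ← hN _ x hx rfl hp, map_smul, LinearMap.smul_apply, map_add, cross_self, zero_add,
      map_smul, ← mul_smul, ← mul_smul, mul_assoc, inv_mul_cancel₀ (mul_ne_zero h0 ht), one_smul]
  · simp only [fanoMap, c, hx, hp, if_false]

/-! #### Configurations of nonzero vectors -/

set_option synthInstance.maxHeartbeats 200000 in
set_option synthInstance.maxSize 1000 in
-- The points `x, y, a, b` form a quadrangle with diagonal points `z = xy ∩ ab`, `c = xa ∩ yb`, `d =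
-- xb ∩ ya`. In the Fano plane these are collinear, and `j` is their line.
lemma exists_fano_labels : ∀ x y a : Fin 7, x ≠ y → ¬ FanoCollinear x y a →
    ∃ z, FanoCollinear x y z ∧ ∃ b, FanoCollinear z a b ∧ ¬ FanoCollinear x y b ∧
      ∃ c, FanoCollinear x a c ∧ FanoCollinear y b c ∧ ¬ FanoCollinear x y c ∧
      ∃ d, FanoCollinear x b d ∧ FanoCollinear y a d ∧ ¬ FanoCollinear x y d ∧
        (∀ e, e = x ∨ e = y ∨ e = z ∨ e = a ∨ e = b ∨ e = c ∨ e = d) ∧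
        ∃ j, ∀ e, e ∉ fanoLine j → e = x ∨ e = y ∨ e = a ∨ e = b := by
  decide +kernel

lemma exists_not_fanoCollinear : ∀ x y : Fin 7, x ≠ y → ∃ a, ¬ FanoCollinear x y a := by
  decide +kernel

/-- The vectors of collinear points are coplanar. -/
lemma FanoCollinear.coplanar₃ (hline : ∀ j, ∃ L ≠ 0, ∀ x ∈ fanoLine j, L ⬝ᵥ γ.vec x = 0)
    {x y z : Fin 7} (h : FanoCollinear x y z) : Coplanar₃ (γ.vec x) (γ.vec y) (γ.vec z) := by
  obtain ⟨j, hx, hy, hz⟩ := h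
  obtain ⟨L, hL, hLj⟩ := hline j
  exact ⟨L, hL, hLj x hx, hLj y hy, hLj z hz⟩

/-- If two of the vectors are parallel, the configuration is of type `A` or `B`. -/
lemma mem_range_fanoMap_of_parallel
    (hline : ∀ j, ∃ L ≠ 0, ∀ x ∈ fanoLine j, L ⬝ᵥ γ.vec x = 0) (hne : ∀ x, γ.vec x ≠ 0)
    (hrank : ¬ ∃ L ≠ 0, ∀ x, L ⬝ᵥ γ.vec x = 0) {x y : Fin 7} (hxy : x ≠ y)
    (hpar : γ.vec x ⨯₃ γ.vec y = 0) : ∃ m, γ ∈ Set.range (fanoMap m) := by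
  have hcop := fun {x y z} => FanoCollinear.coplanar₃ hline (x := x) (y := y) (z := z)
  have hperp : ∀ {x y}, γ.vec x ⨯₃ γ.vec y = 0 → ∀ {L}, L ⬝ᵥ γ.vec x = 0 → L ⬝ᵥ γ.vec y = 0 := by
    intro x y h L hL
    obtain ⟨s, hs⟩ := exists_smul_of_cross_eq_zero (hne x) h
    rw [hs, dotProduct_smul, hL, smul_zero]
  have hypar : ∀ {v}, γ.vec x ⨯₃ v ≠ 0 → γ.vec y ⨯₃ v ≠ 0 := by
    intro v hv h
    obtain ⟨s, hs⟩ := exists_smul_of_cross_eq_zero (hne x) hpar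
    have hs0 : s ≠ 0 := by
      rintro rfl
      exact hne y (by simpa using hs)
    rw [hs, map_smul, LinearMap.smul_apply, smul_eq_zero] at h
    exact hv (h.resolve_left hs0)
  have hL : ∀ v w : Fin 3 → ℂ, ((v ⨯₃ w) ⬝ᵥ v = 0) ∧ ((v ⨯₃ w) ⬝ᵥ w = 0) := fun v w =>
    ⟨by rw [dotProduct_comm, dot_self_cross], by rw [dotProduct_comm, dot_cross_self]⟩
  by_cases hex : ∃ a, ¬ FanoCollinear x y a ∧ γ.vec x ⨯₃ γ.vec a = 0
  · obtain ⟨a, ha, hxa⟩ := hex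
    obtain ⟨z, -, b, hzab, -, c, -, hybc, -, d, hxbd, -, -, hall, j, hj⟩ :=
      exists_fano_labels x y a hxy ha
    -- Otherwise the plane of `x` and `b` contains `y` and `a` by parallelism, then `d`, `c` and `z`
    -- along the lines: all seven vectors.
    have hxb : γ.vec x ⨯₃ γ.vec b = 0 := by
      by_contra hxb
      obtain ⟨hLx, hLb⟩ := hL (γ.vec x) (γ.vec b)
      have hLy := hperp hpar hLx
      have hLa := hperp hxa hLx
      have hLd := (hcop hxbd).dotProduct_eq_zero hxb hLx hLb
      have hLc := (hcop hybc).dotProduct_eq_zero (hypar hxb) hLy hLb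
      have hLz : (γ.vec x ⨯₃ γ.vec b) ⬝ᵥ γ.vec z = 0 := by
        obtain ⟨M, hM, h1, h2, h3⟩ := hcop hzab
        refine Coplanar₃.dotProduct_eq_zero ⟨M, hM, h2, h3, h1⟩ (fun h => hxb ?_) hLa hLb
        obtain ⟨s, hs⟩ := exists_smul_of_cross_eq_zero (hne a) h
        obtain ⟨s', hs'⟩ := exists_smul_of_cross_eq_zero (hne x) hxa
        rw [hs, hs', map_smul, map_smul, cross_self, smul_zero, smul_zero]
      refine hrank ⟨_, hxb, fun e => ?_⟩
      rcases hall e with rfl | rfl | rfl | rfl | rfl | rfl | rfl <;> assumption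
    refine ⟨_, mem_range_fanoMap_A (hline j) ⟨γ.vec x, fun e he => ?_⟩⟩
    rcases hj e he with rfl | rfl | rfl | rfl
    · exact ⟨1, by simp⟩
    · exact exists_smul_of_cross_eq_zero (hne x) hpar
    · exact exists_smul_of_cross_eq_zero (hne x) hxa
    · exact exists_smul_of_cross_eq_zero (hne x) hxb
  · push Not at hex
    -- No point off the line `xy` is parallel to `x`. The plane of `x` and `a` then contains `y`,
    -- `c`, `d` and `b`, hence every vector except the one at `z`.
    obtain ⟨a, ha⟩ := exists_not_fanoCollinear x y hxy
    obtain ⟨z, -, b, -, hb, c, hxac, -, -, d, hxbd, hyad, hd, hall, -⟩ :=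
      exists_fano_labels x y a hxy ha
    obtain ⟨hLx, hLa⟩ := hL (γ.vec x) (γ.vec a)
    have hLy := hperp hpar hLx
    have hLc := (hcop hxac).dotProduct_eq_zero (hex a ha) hLx hLa
    have hLd := (hcop hyad).dotProduct_eq_zero (hypar (hex a ha)) hLy hLa
    have hLb : (γ.vec x ⨯₃ γ.vec a) ⬝ᵥ γ.vec b = 0 := by
      obtain ⟨M, hM, h1, h2, h3⟩ := hcop hxbd
      exact Coplanar₃.dotProduct_eq_zero ⟨M, hM, h1, h3, h2⟩ (hex d hd) hLx hLd
    have hLe : ∀ e, e ≠ z → (γ.vec x ⨯₃ γ.vec a) ⬝ᵥ γ.vec e = 0 := by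
      intro e he
      rcases hall e with rfl | rfl | rfl | rfl | rfl | rfl | rfl <;>
        first | assumption | exact absurd rfl he
    have hLz : (γ.vec x ⨯₃ γ.vec a) ⬝ᵥ γ.vec z ≠ 0 := fun hz => by
      refine hrank ⟨_, hex a ha, fun e => ?_⟩
      by_cases he : e = z
      · rw [he, hz]
      · exact hLe e he
    -- As `z` is off the plane, each line through `z` meets it in one direction, which makes its
    -- other two points parallel.
    refine ⟨_, mem_range_fanoMap_B (k := z) ⟨_, hex a ha, hLe⟩ fun e f he hf _ hef => ?_⟩
    obtain ⟨M, hM, h1, h2, h3⟩ := hcop hef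
    exact Coplanar₃.cross_eq_zero ⟨M, hM, h2, h3, h1⟩ (hLe e he) (hLe f hf) hLz

/-- The Fano plane has no representation in characteristic zero. -/
lemma exists_parallel_of_fano (hline : ∀ j, ∃ L ≠ 0, ∀ x ∈ fanoLine j, L ⬝ᵥ γ.vec x = 0)
    (hrank : ¬ ∃ L ≠ 0, ∀ x, L ⬝ᵥ γ.vec x = 0) :
    ∃ x y, x ≠ y ∧ γ.vec x ⨯₃ γ.vec y = 0 := by
  by_contra! hpar
  have hcop := fun {x y z} => FanoCollinear.coplanar₃ hline (x := x) (y := y) (z := z)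
  have hdet : ∀ {x y z}, FanoCollinear x y z →
      (Matrix.of ![γ.vec x, γ.vec y, γ.vec z]).det = 0 := fun h => coplanar₃_iff_det.1 (hcop h)
  -- A plane through these three vectors would spread along the lines to all seven.
  have hΔ : (Matrix.of ![γ.vec 0, γ.vec 1, γ.vec 3]).det ≠ 0 := by
    intro h
    obtain ⟨L, hL, h0, h1, h3⟩ := coplanar₃_iff_det.2 h
    have h2 := (hcop (z := 2) (by decide)).dotProduct_eq_zero (hpar 0 1 (by decide)) h0 h1
    have h6 := (hcop (z := 6) (by decide)).dotProduct_eq_zero (hpar 0 3 (by decide)) h0 h3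
    have h5 := (hcop (z := 5) (by decide)).dotProduct_eq_zero (hpar 1 3 (by decide)) h1 h3
    have h4 := (hcop (z := 4) (by decide)).dotProduct_eq_zero (hpar 0 5 (by decide)) h0 h5
    refine hrank ⟨L, hL, fun x => ?_⟩
    fin_cases x <;> assumption
  -- Four lines express the remaining points in the basis `0, 1, 3`; the other three lines become
  -- equations between the coefficients.
  obtain ⟨s0, s1, h2⟩ := (hcop (z := 2) (by decide)).exists_eq_add (hpar 0 1 (by decide))
  obtain ⟨w0, w3, h6⟩ := (hcop (z := 6) (by decide)).exists_eq_add (hpar 0 3 (by decide))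
  obtain ⟨u1, u3, h5⟩ := (hcop (z := 5) (by decide)).exists_eq_add (hpar 1 3 (by decide))
  obtain ⟨a0, a5, h4⟩ := (hcop (z := 4) (by decide)).exists_eq_add (hpar 0 5 (by decide))
  have d234 := hdet (x := 2) (y := 3) (z := 4) (by decide)
  have d146 := hdet (x := 1) (y := 4) (z := 6) (by decide)
  have d256 := hdet (x := 2) (y := 5) (z := 6) (by decide)
  have hs0 : s0 ≠ 0 := by
    rintro rfl
    exact hpar 2 1 (by decide) (by rw [h2]; simp)
  have hu1 : u1 ≠ 0 := by
    rintro rfl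
    exact hpar 5 3 (by decide) (by rw [h5]; simp)
  have hu3 : u3 ≠ 0 := by
    rintro rfl
    exact hpar 5 1 (by decide) (by rw [h5]; simp)
  have hw0 : w0 ≠ 0 := by
    rintro rfl
    exact hpar 6 3 (by decide) (by rw [h6]; simp)
  have ha5 : a5 ≠ 0 := by
    rintro rfl
    exact hpar 4 0 (by decide) (by rw [h4]; simp)
  have e0 : ∀ k, γ.vec 2 k = s0 * γ.vec 0 k + s1 * γ.vec 1 k := fun k => by rw [h2]; simp
  have e1 : ∀ k, γ.vec 6 k = w0 * γ.vec 0 k + w3 * γ.vec 3 k := fun k => by rw [h6]; simp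
  have e2 : ∀ k, γ.vec 5 k = u1 * γ.vec 1 k + u3 * γ.vec 3 k := fun k => by rw [h5]; simp
  have e3 : ∀ k, γ.vec 4 k = a0 * γ.vec 0 k + a5 * (u1 * γ.vec 1 k + u3 * γ.vec 3 k) := fun k => by
    rw [h4, ← e2]; simp
  simp only [Matrix.det_fin_three, Matrix.of_apply, Matrix.cons_val, e0, e1, e2, e3] at d234 d146 d256 hΔ
  have r1 : s1 * a0 - s0 * a5 * u1 = 0 := by
    refine (mul_eq_zero.1 ?_).resolve_left hΔ
    linear_combination d234
  have r2 : a0 * w3 - a5 * u3 * w0 = 0 := by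
    refine (mul_eq_zero.1 ?_).resolve_left hΔ
    linear_combination -d146
  have r3 : s0 * u1 * w3 + s1 * u3 * w0 = 0 := by
    refine (mul_eq_zero.1 ?_).resolve_left hΔ
    linear_combination d256
  -- The three equations are inconsistent except for the factor `2`: this is where the
  -- characteristic enters.
  have : 2 * (s0 * u1 * a5 * u3 * w0) = 0 := by
    linear_combination a0 * r3 - s0 * u1 * r2 - u3 * w0 * r1
  simp [hs0, hu1, hu3, hw0, ha5] at this

/-! #### The components cover the circuit variety -/

lemma fano_ground : fano.E = Set.univ := rfl

lemma exists_mem_closure_range_fanoMap (hγ : γ ∈ circuitVariety 3 fano) :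
    ∃ m, γ ∈ closure (Set.range (fanoMap m)) := by
  by_cases hrank : ∃ L ≠ 0, ∀ x, L ⬝ᵥ γ.vec x = 0
  · exact ⟨_, subset_closure (mem_range_fanoMap_uniform hrank)⟩
  have hline : ∀ j, ∃ L ≠ 0, ∀ x ∈ fanoLine j, L ⬝ᵥ γ.vec x = 0 := by
    intro j
    refine (exists_dotProduct_eq_zero_iff (T := (fanoLine j : Set (Fin 7)))).2 fun S hSj hS => ?_
    have hI := (mem_circuitVariety_iff fano_ground).1 hγ S hS
    lift S to Finset (Fin 7) using S.toFinite with I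
    rw [fano_indep_iff] at hI
    rw [Set.ncard_coe_finset]
    by_contra! hlt
    have hsub := Finset.coe_subset.1 hSj
    exact hI.2 j (Finset.eq_of_subset_of_card_le hsub (by rw [fanoLine_card]; omega)).symm.subset
  by_cases h0 : ∃ i, γ.vec i = 0
  · obtain ⟨i, hi⟩ := h0
    exact ⟨_, mem_closure_range_fanoMap_makeLoop hi (fun j _ => hline j) hrank⟩
  push Not at h0
  obtain ⟨x, y, hxy, hpar⟩ := exists_parallel_of_fano hline hrank
  obtain ⟨m, hm⟩ := mem_range_fanoMap_of_parallel hline h0 hrank hxy hpar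
  exact ⟨m, subset_closure hm⟩

lemma exists_indep_card_three : ∀ i, ∃ I : Finset (Fin 7),
    FanoComponentIndep (.inr (.inl i)) I ∧ I.card = 3 := by
  decide +kernel

/-- Realizations satisfy the geometric hypotheses of the same membership lemmas that cover the
circuit variety, so no separate parametrization argument is needed. -/
lemma realizationSpace_fanoComponent_subset (m) :
    realizationSpace 3 (fanoComponent m) ⊆ closure (Set.range (fanoMap m)) := by
  intro γ hγ
  have hind : ∀ I : Finset (Fin 7), LinearIndepOn ℂ γ.vec (I : Set (Fin 7)) ↔
      FanoComponentIndep m I := fun I => by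
    rw [(mem_realizationSpace_iff (fanoComponent_ground m)).1 hγ, fanoComponent_indep_iff]
  have hplane : ∀ J : Finset (Fin 7), (∀ I ⊆ J, FanoComponentIndep m I → I.card ≤ 2) →
      ∃ L ≠ 0, ∀ x ∈ J, L ⬝ᵥ γ.vec x = 0 := by
    refine fun J hJ => (exists_dotProduct_eq_zero_iff (T := (J : Set (Fin 7)))).2 fun S hSJ hS => ?_
    lift S to Finset (Fin 7) using S.toFinite with I
    rw [Set.ncard_coe_finset]
    exact hJ I (Finset.coe_subset.1 hSJ) ((hind I).1 hS)
  have hpair : ∀ x y, x ≠ y → ¬ FanoComponentIndep m {x, y} → γ.vec x ⨯₃ γ.vec y = 0 := by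
    intro x y hxy h
    by_contra hc
    rw [← ne_eq, ← linearIndepOn_pair_iff_cross hxy] at hc
    exact h ((hind _).1 (by simpa using hc))
  rcases m with _ | i | j | k
  · obtain ⟨L, hL, h⟩ := hplane Finset.univ fun I _ hI => hI
    exact subset_closure (mem_range_fanoMap_uniform ⟨L, hL, fun x => h x (Finset.mem_univ x)⟩)
  · refine mem_closure_range_fanoMap_makeLoop ?_ (fun j hj => hplane _ fun I hIj hI => ?_) ?_
    · by_contra hne
      have := (hind {i}).1 (by simpa using (linearIndepOn_singleton_iff ℂ).2 hne)
      exact this.2 (Finset.mem_singleton_self i)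
    · by_contra! hlt
      exact hI.1.2 j (Finset.eq_of_subset_of_card_le hIj (by rw [fanoLine_card]; omega)).symm.subset
    · rintro ⟨L, hL, h⟩
      obtain ⟨I, hI, hI3⟩ := exists_indep_card_three i
      have := ncard_le_of_dotProduct_eq_zero ((hind I).2 hI) hL fun x _ => h x
      rw [Set.ncard_coe_finset] at this
      omega
  · refine subset_closure (mem_range_fanoMap_A (hplane _ fun I hIj hI => ?_) ?_)
    · have := hI.1
      rwa [Finset.inter_eq_left.2 hIj] at this
    · obtain ⟨v, -, hv⟩ := exists_forall_eq_smul (γ := γ) (T := {x | x ∉ fanoLine j})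
        fun x hx y hy hxy => hpair x y hxy fun h => by
          have := h.2
          rw [Finset.sdiff_eq_self_of_disjoint (by
            rw [Finset.disjoint_left]
            simpa using And.intro hx hy), Finset.card_pair hxy] at this
          omega
      exact ⟨v, hv⟩
  · refine subset_closure (mem_range_fanoMap_B ?_ fun x y hx hy hxy hc => hpair x y hxy fun h => ?_)
    · obtain ⟨L, hL, h⟩ := hplane (Finset.univ.erase k) fun I hIk hI => by
        have := hI.1
        rwa [Finset.erase_eq_of_notMem fun hk => Finset.notMem_erase k _ (hIk hk)] at this
      exact ⟨L, hL, fun x hx => h x (by simp [hx])⟩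
    · exact h.2 x (by simp [hx]) y (by simp [hy]) hxy hc

lemma matroidVariety_fanoComponent (m) :
    matroidVariety 3 (fanoComponent m) = closure (Set.range (fanoMap m)) := by
  refine matroidVariety_eq_closure (fanoComponent_ground m) (isIrreducible_range_fanoMap m) ?_
    (exists_fanoMap_mem_realizationSpace m) (realizationSpace_fanoComponent_subset m)
  rintro _ ⟨p, rfl⟩
  exact fanoMap_mem_circuitVariety m p

lemma circuitVariety_fano_eq_iUnion :
    circuitVariety 3 fano = ⋃ m, matroidVariety 3 (fanoComponent m) := by
  refine Set.Subset.antisymm (fun γ hγ => ?_) (Set.iUnion_subset fun m => ?_)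
  · obtain ⟨m, hm⟩ := exists_mem_closure_range_fanoMap hγ
    exact Set.mem_iUnion.2 ⟨m, by rwa [matroidVariety_fanoComponent]⟩
  · refine matroidVariety_subset_circuitVariety fun S hS => ?_
    rw [← Matroid.not_indep_iff (by simp [fanoComponent_ground])]
    refine fun h => hS.not_indep ?_
    lift S to Finset (Fin 7) using S.toFinite with I
    rw [fanoComponent_indep_iff] at h
    exact (fano_indep_iff I).2 (fanoComponentIndep_imp m I h)

/-- Assuming only an inclusion serves twice: it excludes redundant components, and it makes the
indexing injective for the count `1 + 7 + 7 + 7 = 22`. -/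
lemma eq_of_matroidVariety_fanoComponent_subset (m m')
    (h : matroidVariety 3 (fanoComponent m) ⊆ matroidVariety 3 (fanoComponent m')) : m = m' := by
  by_contra hne
  obtain ⟨x, y, z, hI, hD⟩ := exists_indep_not_indep m m' hne
  rw [← fanoComponent_indep_iff] at hI hD
  rw [Matroid.not_indep_iff (by simp [fanoComponent_ground])] at hD
  exact (dep_of_matroidVariety_subset ((exists_fanoMap_mem_realizationSpace m).mono
    Set.inter_subset_right) h hD).not_indep hI

lemma componentsOf_circuitVariety_fano : componentsOf (circuitVariety 3 fano) =
    Set.range fun m => matroidVariety 3 (fanoComponent m) := by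
  refine componentsOf_eq_range circuitVariety_fano_eq_iUnion (fun m => isClosed_closure)
    (fun m => ?_) eq_of_matroidVariety_fanoComponent_subset
  rw [matroidVariety_fanoComponent]
  exact (isIrreducible_range_fanoMap m).closure

end Covering
theorem mainTheorem6 :
    circuitVariety 3 fano =
        matroidVariety 3 (uniformMatroid 2 7) ∪ (⋃ i : Fin 7, matroidVariety 3 (fano.makeLoop i)) ∪
          (⋃ j : Fin 7, matroidVariety 3 (fanoA j)) ∪ (⋃ k : Fin 7, matroidVariety 3 (fanoB k)) ∧
      componentsOf (circuitVariety 3 fano) =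
        {matroidVariety 3 (uniformMatroid 2 7)} ∪
          Set.range (fun i : Fin 7 => matroidVariety 3 (fano.makeLoop i)) ∪
          Set.range (fun j : Fin 7 => matroidVariety 3 (fanoA j)) ∪
          Set.range (fun k : Fin 7 => matroidVariety 3 (fanoB k)) ∧
      (componentsOf (circuitVariety 3 fano)).ncard = 22 := by
  refine ⟨?_, ?_, ?_⟩
  · rw [circuitVariety_fano_eq_iUnion]
    simp only [Set.iUnion_sum, fanoComponent, Sum.elim_inl, Sum.elim_inr, Set.iUnion_const,
      Set.union_assoc]
  · rw [componentsOf_circuitVariety_fano]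
    ext Z
    simp only [Set.mem_range, Sum.exists, fanoComponent, Sum.elim_inl, Sum.elim_inr,
      Set.mem_union, Set.mem_singleton_iff, or_assoc, exists_const, eq_comm (a := Z)]
  · rw [componentsOf_circuitVariety_fano, ← Set.image_univ, Set.ncard_image_of_injective _
      fun m m' h => eq_of_matroidVariety_fanoComponent_subset m m' h.subset]
    simp [Set.ncard_univ, Nat.card_eq_fintype_card]
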